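/- **Lemma (Approximate TMA sample complexity).** *Setting.* Let $\mathcal S,\mathcal A$ be finite with $S=|\mathcal S|$, $A=|\mathcal A|$, let $\gamma\in(0,1)$, let $c:\mathcal S\times\mathcal A\times\mathcal S\to\mathbb R$ satisfy $|c|\le C$ with $C>0$, and let $\rho$ be a starting distribution with $\rho(s)>0$ for all $s$. Let $\Pi$ be a class of policies and $\pi\in\Pi$. Let $\mathcal P=\prod_s\mathcal P_s$ be an $s$-rectangular uncertainty set of transition kernels with convex factors $\mathcal P_s\subseteq\Delta(\mathcal S)^{\mathcal A}$ ($(s,a)$-rectangular sets are a special case). Write $V_{\pi,p}(\rho)=\mathbb E\sum_{l\ge0}\gamma^l c(s_l,a_l,s_{l+1})$ and $d^{\pi,p}_\rho(s)=(1-\gamma)\sum_{l\ge0}\gamma^l\,\mathbb P(s_l=s)$ for the chain started from $\rho$ and driven by $\pi,p$. Let $p^*\in\arg\max_{p\in\mathcal P}V_{\pi,p}(\rho)$. For each $s$ let $h_s:\mathcal P_s\to\mathbb R$ be convex, with Bregman divergence $B(x,y)=h_s(x)-h_s(y)-\langle\nabla h_s(y),x-y\rangle$, and put $B_w(q,p)=\sum_s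 w(s)B(q(\cdot|s,\cdot),p(\cdot|s,\cdot))$. We assume that $h_s$ is differentiable (relative to $\mathcal P_s$) at $p^0(\cdot|s,\cdot)$, where $p^0\in\mathcal P$ is the initial kernel, and that for every point $y$ of differentiability, every linear $g$ and every maximiser $x$ of $\langle g,\cdot\rangle-B(\cdot,y)$ over $\mathcal P_s$, $h_s$ is differentiable at $x$; both are automatic if $h_s$ is differentiable on $\mathcal P_s$. *Algorithm.* Approximate TMA with $t'$ iterations, horizon $H$, $M_G$ trajectories per triple, step sizes $\eta(t)$ and penalty $\alpha>0$ starts at $p^0$. At iteration $t=0,\dots,t'-1$ it draws, for each $(s,a,s')$, $M_G$ independent trajectories of $H$ transitions under $\pi,p^t$ with $s_0=s,a_0=a,s_1=s'$, lets $\hat G(s,a,s')$ be the average over them of $\sum_{l=0}^{H-1}\gamma^l c(s_l,a_l,s_{l+1})$, and takes $p^{t+1}$ to be a maximiser over $q\in\mathcal P$ of $$\eta(t)\sum_{s,a}d^{\pi,p^t}_\rho(s)\,\pi(a|s)\,\langle q(\cdot|s,a),\hat G(s,a,\cdot)\rangle-\alpha B_{d^{\pi,p^t}_\rho}(q,p^t)$$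 (maximisers are assumed to exist; any fixed rule may choose among them). The number $n$ of samples is the total number of transitions in all trajectories. The step sizes satisfy $\eta(0)>0$, $$\eta(0)\ge\frac{\alpha}{C}\,\frac{1-\gamma}{\gamma}\,B_{d^{\pi,p^*}_\rho}(p^*,p^0),\qquad \eta(t+1)=\eta(t)/\gamma .$$ *Constant $M$.* Let $M$ be any real number with $M\ge\frac1{1-\gamma}$ and $M\ge\sup_{p\in\mathcal P}\big\|d^{\pi,p^*}_\rho/d^{\pi,p}_\rho\big\|_\infty$. *Claim.* The normalised mismatch coefficient $\frac1{1-\gamma}\sup_{p\in\mathcal P,\pi'\in\Pi}\|d^{\pi',p}_\rho/\rho\|_\infty$ is an admissible choice of $M$. Moreover, for every admissible $M$, every $\epsilon'>0$ and every $\delta\in(0,1)$: 1. If $$t'\ge\log_{\frac{M}{M-1}}\!\Big(\frac{6C}{\epsilon'(1-\gamma)}\Big),\qquad H\ge\log_{\frac1\gamma}\!\Big(\frac{16MC}{(1-\gamma)^2\epsilon'}\Big),\qquad M_G\ge2\Big(\frac{16MC}{(1-\gamma)^2\epsilon'}\Big)^2\log\Big(\frac{2S^2At'}{\delta}\Big)$$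 are natural numbers (for $t'=0$ the last bound is read as $M_G\ge0$), then with probability at least $1-\delta$ the returned kernel satisfies $p^{t'}\in\mathcal P$ and $V_{\pi,p^*}(\rho)-V_{\pi,p^{t'}}(\rho)\le\epsilon'$, and the number of samples is always $n=S^2A\,t'\,H\,M_G$. 2. If $\epsilon'\le\frac{6C}{1-\gamma}$ and $t',H,M_G$ are the smallest such natural numbers, then $n=\tilde{\mathcal O}\big(\frac{S^2AM^3}{(1-\gamma)^4\epsilon'^2}\big)$, where $\tilde{\mathcal O}$ also hides $C^2$ and the factor $\log_{1/\gamma}(\cdot)$ coming from the horizon; explicitly $$n\le1024\,\frac{S^2A\,C^2M^2}{(1-\gamma)^4\epsilon'^2}\Big(1+\log_{\frac M{M-1}}\tfrac{6C}{\epsilon'(1-\gamma)}\Big)\Big(1+\log_{\frac1\gamma}\tfrac{16MC}{(1-\gamma)^2\epsilon'}\Big)\log\frac{2S^2At'}{\delta}$$ and $$n\le1024\,\frac{S^2A\,C^2M^3}{(1-\gamma)^4\epsilon'^2}\Big(1+\log\tfrac{6C}{\epsilon'(1-\gamma)}\Big)\Big(1+\log_{\frac1\gamma}\tfrac{16MC}{(1-\gamma)^2\epsilon'}\Big)\log\frac{2S^2At'}{\delta}$$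 (for $t'=0$, $n=0$ and the right-hand sides are read as $0$). -/

import Mathlib

noncomputable section

namespace ApproxTMA

variable {S A : Type*} [Fintype S] [Fintype A]

/-- Stationary randomised policies. -/
abbrev Policy (S A : Type*) [Fintype A] := S → stdSimplex ℝ A

/-- Transition kernels `p(s' | s, a)`. -/
abbrev TransKernel (S A : Type*) [Fintype S] := S → A → stdSimplex ℝ S

/-- The block `p(· | s, ·)` of a transition kernel at the state `s`, as a real vector. -/
def block (p : TransKernel S A) (s : S) : A → S → ℝ := fun a s' => (p s a).1 s'

/-- The `s`-rectangular uncertainty set with factors `U s`. An `(s,a)`-rectangular set is the case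
in which every `U s` is a product over the actions. -/
def rectSet (U : S → Set (A → S → ℝ)) : Set (TransKernel S A) :=
  {p | ∀ s, block p s ∈ U s}

/-! ### Occupancy measures and values -/

/-- `ℙ(s_l = s)` for the chain started from `ρ` and driven by `π` and `p`. -/
def stateProb (ρ : stdSimplex ℝ S) (π : Policy S A) (p : TransKernel S A) : ℕ → S → ℝ
  | 0 => fun s => ρ.1 s
  | l + 1 => fun s' => ∑ s, ∑ a, stateProb ρ π p l s * (π s).1 a * (p s a).1 s'

/-- The discounted state visitation distribution. -/
def visitation (γ : ℝ) (ρ : stdSimplex ℝ S) (π : Policy S A) (p : TransKernel S A) (s : S) : ℝ :=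
  (1 - γ) * ∑' l : ℕ, γ ^ l * stateProb ρ π p l s

/-- The value `V_{π,p}(ρ) = ∑_l γ^l 𝔼[c(s_l, a_l, s_{l+1})]`. -/
def value (γ : ℝ) (c : S → A → S → ℝ) (ρ : stdSimplex ℝ S) (π : Policy S A)
    (p : TransKernel S A) : ℝ :=
  ∑' l : ℕ, γ ^ l *
    ∑ s, ∑ a, ∑ s', stateProb ρ π p l s * (π s).1 a * (p s a).1 s' * c s a s'

/-- The mismatch coefficient: supremum over `π' ∈ Pol`, `p ∈ P` of `‖d_ρ^{π',p} / ρ‖_∞`. -/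
def mismatch (γ : ℝ) (ρ : stdSimplex ℝ S) (Pol : Set (Policy S A))
    (P : Set (TransKernel S A)) : ℝ :=
  ⨆ x : Pol × P, ⨆ s, visitation γ ρ x.1.1 x.2.1 s / ρ.1 s

/-- The density ratio `sup_{p ∈ P} ‖d_ρ^{π,p*} / d_ρ^{π,p}‖_∞`. -/
def densityRatio (γ : ℝ) (ρ : stdSimplex ℝ S) (π : Policy S A)
    (P : Set (TransKernel S A)) (pstar : TransKernel S A) : ℝ :=
  ⨆ p : P, ⨆ s, visitation γ ρ π pstar s / visitation γ ρ π p.1 s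

/-! ### Bregman divergences and the mirror ascent step -/

/-- The Bregman divergence on `K` generated by `h`. For `x`, `y` in a convex set `K` and `h`
differentiable within `K` at `y`, the derivative in the direction `x - y` is uniquely determined. -/
def bregman (K : Set (A → S → ℝ)) (h : (A → S → ℝ) → ℝ) (x y : A → S → ℝ) : ℝ :=
  h x - h y - fderivWithin ℝ h K y (x - y)

/-- `h` is a distance generating function on `K`: it is convex on `K` (in particular `K` is convex),
and a proximal step from a point of differentiability ends in a point of differentiability. The
second clause is automatic if `h` is differentiable on `K`; it allows generators such as the
negative entropy whose gradient blows up at the boundary of the simplex. -/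
def IsDistanceGenerating (K : Set (A → S → ℝ)) (h : (A → S → ℝ) → ℝ) : Prop :=
  ConvexOn ℝ K h ∧
    ∀ y ∈ K, DifferentiableWithinAt ℝ h K y → ∀ g : A → S → ℝ, ∀ x ∈ K,
      IsMaxOn (fun z => ∑ a, ∑ s', g a s' * z a s' - bregman K h z y) K x →
        DifferentiableWithinAt ℝ h K x

/-- The weighted Bregman divergence `B_w(q, p) = ∑_s w(s) B(q(·|s,·), p(·|s,·))`. -/
def weightedBregman (U : S → Set (A → S → ℝ)) (h : S → (A → S → ℝ) → ℝ) (w : S → ℝ)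
    (q p : TransKernel S A) : ℝ :=
  ∑ s, w s * bregman (U s) (h s) (block q s) (block p s)

/-- The objective in `q` of a transition mirror ascent step from `p`, for the estimate `Ghat`:
`η ∑_{s,a} d(s,a) ⟨q(·|s,a), Ghat(s,a,·)⟩ - α B_d(q, p)` with `d = d_ρ^{π,p}`. -/
def tmaObjective (γ : ℝ) (ρ : stdSimplex ℝ S) (π : Policy S A) (U : S → Set (A → S → ℝ))
    (h : S → (A → S → ℝ) → ℝ) (η α : ℝ) (p : TransKernel S A) (Ghat : S → A → S → ℝ)
    (q : TransKernel S A) : ℝ :=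
  η * (∑ s, ∑ a, visitation γ ρ π p s * (π s).1 a * ∑ s', (q s a).1 s' * Ghat s a s')
    - α * weightedBregman U h (visitation γ ρ π p) q p

/-- `upd t p Ghat` is, for each iteration `t`, current kernel `p` and estimate `Ghat`, a maximiser
over the uncertainty set of the mirror ascent objective with step size `η t` and penalty `α`. -/
def IsTMAUpdate (γ : ℝ) (ρ : stdSimplex ℝ S) (π : Policy S A) (U : S → Set (A → S → ℝ))
    (h : S → (A → S → ℝ) → ℝ) (η : ℕ → ℝ) (α : ℝ)
    (upd : ℕ → TransKernel S A → (S → A → S → ℝ) → TransKernel S A) : Prop :=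
  ∀ t p Ghat, p ∈ rectSet U →
    (∀ s, DifferentiableWithinAt ℝ (h s) (U s) (block p s)) →
      upd t p Ghat ∈ rectSet U ∧
        IsMaxOn (tmaObjective γ ρ π U h (η t) α p Ghat) (rectSet U) (upd t p Ghat)

/-! ### Sampling -/

/-- A probability vector as a probability mass function. -/
def toPMF {ι : Type*} [Fintype ι] (v : stdSimplex ℝ ι) : PMF ι :=
  PMF.ofFintype (fun i => ENNReal.ofReal (v.1 i)) (by
    rw [← ENNReal.ofReal_sum_of_nonneg (fun i _ => v.2.1 i), v.2.2, ENNReal.ofReal_one])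

/-- The law of a family of independent random variables with laws `μ i`. -/
def indepPMF {ι β : Type*} [Fintype ι] [DecidableEq ι] [Fintype β] (μ : ι → PMF β) :
    PMF (ι → β) :=
  PMF.ofFintype (fun f => ∏ i, μ i (f i)) (by
    rw [← Fintype.prod_sum]
    refine Finset.prod_eq_one fun i _ => ?_
    rw [← tsum_fintype (L := .unconditional _)]
    exact (μ i).tsum_coe)

/-- The law of the first `H` transitions `(s_l, a_l, s_{l+1})`, `l < H`, of a trajectory of `π` and
`p` whose first transition is the given one. -/
def trajLaw (π : Policy S A) (p : TransKernel S A) :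
    (H : ℕ) → S × A × S → PMF (Fin H → S × A × S)
  | 0, _ => PMF.pure Fin.elim0
  | H + 1, x =>
      (toPMF (π x.2.2)).bind fun a =>
        (toPMF (p x.2.2 a)).bind fun s' =>
          (trajLaw π p H (x.2.2, a, s')).map fun τ => Fin.cons x τ

/-- A mini-batch: `N` trajectories of `H` transitions for each triple `(s, a, s')`. -/
abbrev Batch (S A : Type*) (N H : ℕ) := (S × A × S) × Fin N → Fin H → S × A × S

/-- The number of sampled transitions in a mini-batch. -/
def batchSize (S A : Type*) [Fintype S] [Fintype A] (N H : ℕ) : ℕ :=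
  Fintype.card (((S × A × S) × Fin N) × Fin H)

/-- The law of a mini-batch: all trajectories are independent, and those of index `(s, a, s')`
start with the transition `(s, a, s')`. -/
def batchLaw [DecidableEq S] [DecidableEq A] (π : Policy S A) (p : TransKernel S A) (N H : ℕ) :
    PMF (Batch S A N H) :=
  indepPMF fun i => trajLaw π p H i.1

/-- The Monte Carlo estimate of the action next-state value function. -/
def estimate (γ : ℝ) (c : S → A → S → ℝ) {N H : ℕ} (ω : Batch S A N H) : S → A → S → ℝ :=
  fun s a s' => (1 / (N : ℝ)) * ∑ j : Fin N, ∑ l : Fin H,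
    γ ^ (l : ℕ) * c (ω ((s, a, s'), j) l).1 (ω ((s, a, s'), j) l).2.1 (ω ((s, a, s'), j) l).2.2

/-- Approximate TMA: the joint law of the kernel after `t` iterations and of the number of
transitions sampled so far. Each iteration draws a fresh mini-batch from the current kernel. -/
def approxTMA [DecidableEq S] [DecidableEq A] (γ : ℝ) (c : S → A → S → ℝ) (π : Policy S A)
    (upd : ℕ → TransKernel S A → (S → A → S → ℝ) → TransKernel S A) (p0 : TransKernel S A)
    (N H : ℕ) : ℕ → PMF (TransKernel S A × ℕ)
  | 0 => PMF.pure (p0, 0)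
  | t + 1 =>
      (approxTMA γ c π upd p0 N H t).bind fun x =>
        (batchLaw π x.1 N H).map fun ω =>
          (upd t x.1 (estimate γ c ω), x.2 + batchSize S A N H)

end ApproxTMA

end

open ApproxTMA

/-!
A step of transition mirror ascent decouples over the states, since the objective is a sum over the
states with positive weights `d^{π,p}(s) ≥ (1 - γ) ρ(s)` and the uncertainty set is a product
(`tmaObjective_eq`, `isMaxOn_block`). At each state first-order optimality of the proximal point is
the three-point inequality `bregman_three_point`. Used with the current kernel as comparison point
it says that the estimated advantage of the new kernel is nonnegative at every state, so that
passing from the weights `d^{π,p*}` to the weights `d^{π,q}` of the new kernel `q` costs at most the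
factor `M`; used with `p*` it bounds what is left of the optimality gap by a difference of
divergences. The identity `performance_difference` turns the weighted sums of advantages into
differences of values. The result is `tma_step`: up to the error of the estimate, the gap contracts
by the factor `1 - 1 / M`. The divergence terms telescope because the step sizes grow by the factor
`1 / γ` and `γ ≤ 1 - 1 / M`; the invariant that is propagated is `IsGood`.

For the sampling, `pmfMean_trajLaw` identifies the mean of a truncated trajectory cost with the
first `H` terms of the series for the action next-state value function, and the remaining terms are
at most `γ ^ H C / (1 - γ)`. Hoeffding's inequality and a union bound over the triples give
`estimate_uniform`. The mini-batch is fresh in each iteration, so the algorithm is a Markov chain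
and the failure probabilities of its steps add up (`approxTMA_bad_le`).

The number of samples is deterministic. Its bound uses that rounding up at most doubles the
mini-batch size and that `log (M / (M - 1)) ≥ 1 / M` (`sample_complexity`).
-/

namespace ApproxTMA

variable {S A : Type*} [Fintype S] [Fintype A]

/-! ### Occupancy measures, values and the performance difference identity -/

theorem simplex_nonneg {ι : Type*} [Fintype ι] (v : stdSimplex ℝ ι) (i : ι) : 0 ≤ v.1 i := v.2.1 i

theorem simplex_sum {ι : Type*} [Fintype ι] (v : stdSimplex ℝ ι) : ∑ i, v.1 i = 1 := v.2.2

theorem abs_sum_simplex_mul_le {ι : Type*} [Fintype ι] (v : stdSimplex ℝ ι) {f : ι → ℝ} {b : ℝ}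
    (hf : ∀ i, |f i| ≤ b) : |∑ i, v.1 i * f i| ≤ b := by
  calc |∑ i, v.1 i * f i| ≤ ∑ i, |v.1 i * f i| := Finset.abs_sum_le_sum_abs _ _
    _ ≤ ∑ i, v.1 i * b := by
        refine Finset.sum_le_sum fun i _ => ?_
        rw [abs_mul, abs_of_nonneg (simplex_nonneg v i)]
        exact mul_le_mul_of_nonneg_left (hf i) (simplex_nonneg v i)
    _ = b := by rw [← Finset.sum_mul, simplex_sum, one_mul]

/-- The average of `F(s, a, s')` over an action `a ∼ π(· | s)` and a next state
`s' ∼ q(· | s, a)`. -/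
def stepMean (π : Policy S A) (q : TransKernel S A) (F : S → A → S → ℝ) (s : S) : ℝ :=
  ∑ a, (π s).1 a * ∑ s', (q s a).1 s' * F s a s'

theorem abs_stepMean_le (π : Policy S A) (q : TransKernel S A) {F : S → A → S → ℝ} {b : ℝ}
    (hF : ∀ s a s', |F s a s'| ≤ b) (s : S) : |stepMean π q F s| ≤ b :=
  abs_sum_simplex_mul_le _ fun a => abs_sum_simplex_mul_le _ fun s' => hF s a s'

theorem stepMean_add (π : Policy S A) (q : TransKernel S A) (F G : S → A → S → ℝ) (s : S) :
    stepMean π q (F + G) s = stepMean π q F s + stepMean π q G s := by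
  simp only [stepMean, Pi.add_apply, mul_add, Finset.sum_add_distrib]

theorem stepMean_sub (π : Policy S A) (q : TransKernel S A) (F G : S → A → S → ℝ) (s : S) :
    stepMean π q (F - G) s = stepMean π q F s - stepMean π q G s := by
  simp only [stepMean, Pi.sub_apply, mul_sub, Finset.sum_sub_distrib]

theorem stepMean_smul (π : Policy S A) (q : TransKernel S A) (r : ℝ) (F : S → A → S → ℝ) (s : S) :
    stepMean π q (r • F) s = r * stepMean π q F s := by
  simp only [stepMean, Pi.smul_apply, smul_eq_mul, Finset.mul_sum]
  exact Finset.sum_congr rfl fun a _ => Finset.sum_congr rfl fun s' _ => by ring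

theorem stateProb_nonneg (ρ : stdSimplex ℝ S) (π : Policy S A) (p : TransKernel S A) (l : ℕ)
    (s : S) : 0 ≤ stateProb ρ π p l s := by
  induction l generalizing s with
  | zero => exact simplex_nonneg ρ s
  | succ l ih =>
    exact Finset.sum_nonneg fun s₁ _ => Finset.sum_nonneg fun a _ =>
      mul_nonneg (mul_nonneg (ih s₁) (simplex_nonneg _ a)) (simplex_nonneg _ s)

/-- One step of the chain, dually: the mean of `f` after `l + 1` steps is the mean after `l` steps
of the one-step average of `f`. -/
theorem sum_stateProb_succ (ρ : stdSimplex ℝ S) (π : Policy S A) (p : TransKernel S A) (l : ℕ)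
    (f : S → ℝ) :
    ∑ s, stateProb ρ π p (l + 1) s * f s =
      ∑ s, stateProb ρ π p l s * stepMean π p (fun _ _ s' => f s') s := by
  simp only [stateProb, stepMean, Finset.sum_mul, Finset.mul_sum]
  rw [Finset.sum_comm]
  refine Finset.sum_congr rfl fun s _ => ?_
  rw [Finset.sum_comm]
  exact Finset.sum_congr rfl fun a _ => Finset.sum_congr rfl fun s' _ => by ring

theorem sum_stateProb (ρ : stdSimplex ℝ S) (π : Policy S A) (p : TransKernel S A) (l : ℕ) :
    ∑ s, stateProb ρ π p l s = 1 := by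
  induction l with
  | zero => exact simplex_sum ρ
  | succ l ih =>
    have := sum_stateProb_succ ρ π p l fun _ => 1
    simpa [stepMean, simplex_sum, ih] using this

/-- The law of the `l`-th state as a point of the simplex. -/
def stateLaw (ρ : stdSimplex ℝ S) (π : Policy S A) (p : TransKernel S A) (l : ℕ) : stdSimplex ℝ S :=
  ⟨stateProb ρ π p l, stateProb_nonneg ρ π p l, sum_stateProb ρ π p l⟩

theorem summable_discounted {γ : ℝ} (hγ0 : 0 < γ) (hγ1 : γ < 1) {u : ℕ → ℝ} {b : ℝ}
    (hu : ∀ l, |u l| ≤ b) : Summable fun l => γ ^ l * u l := by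
  refine Summable.of_norm_bounded ((summable_geometric_of_lt_one hγ0.le hγ1).mul_right b) fun l => ?_
  rw [Real.norm_eq_abs, abs_mul, abs_of_pos (pow_pos hγ0 l)]
  exact mul_le_mul_of_nonneg_left (hu l) (pow_pos hγ0 l).le

theorem abs_tsum_discounted_le {γ : ℝ} (hγ0 : 0 < γ) (hγ1 : γ < 1) {u : ℕ → ℝ} {b : ℝ}
    (hu : ∀ l, |u l| ≤ b) : |∑' l, γ ^ l * u l| ≤ b / (1 - γ) := by
  have h := tsum_of_norm_bounded
    ((hasSum_geometric_of_lt_one hγ0.le hγ1).mul_right b) (f := fun l => γ ^ l * u l) fun l => by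
      rw [Real.norm_eq_abs, abs_mul, abs_of_pos (pow_pos hγ0 l)]
      exact mul_le_mul_of_nonneg_left (hu l) (pow_pos hγ0 l).le
  rw [div_eq_inv_mul]
  exact h

theorem summable_stateProb_mul {γ : ℝ} (hγ0 : 0 < γ) (hγ1 : γ < 1) (ρ : stdSimplex ℝ S)
    (π : Policy S A) (p : TransKernel S A) (f : S → ℝ) :
    Summable fun l => γ ^ l * ∑ s, stateProb ρ π p l s * f s :=
  summable_discounted hγ0 hγ1 (b := ‖f‖) fun l =>
    abs_sum_simplex_mul_le (stateLaw ρ π p l) fun s => norm_le_pi_norm f s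

theorem summable_stateProb {γ : ℝ} (hγ0 : 0 < γ) (hγ1 : γ < 1) (ρ : stdSimplex ℝ S)
    (π : Policy S A) (p : TransKernel S A) (s : S) :
    Summable fun l => γ ^ l * stateProb ρ π p l s := by
  classical
  simpa [Pi.single_apply] using summable_stateProb_mul hγ0 hγ1 ρ π p (Pi.single s 1)

theorem sum_visitation_mul {γ : ℝ} (hγ0 : 0 < γ) (hγ1 : γ < 1) (ρ : stdSimplex ℝ S)
    (π : Policy S A) (p : TransKernel S A) (f : S → ℝ) :
    ∑ s, visitation γ ρ π p s * f s =
      (1 - γ) * ∑' l, γ ^ l * ∑ s, stateProb ρ π p l s * f s := by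
  simp only [visitation, mul_assoc, ← Finset.mul_sum, ← tsum_mul_right]
  rw [← Summable.tsum_finsetSum]
  · simp only [Finset.mul_sum]
  · intro s _
    simpa only [mul_assoc] using (summable_stateProb hγ0 hγ1 ρ π p s).mul_right (f s)

/-- The flow equation of the visitation distribution, tested against `V`: the discounted increments
of `V` along the chain telescope to its initial mean. -/
theorem sum_visitation_flow {γ : ℝ} (hγ0 : 0 < γ) (hγ1 : γ < 1) (ρ : stdSimplex ℝ S)
    (π : Policy S A) (p : TransKernel S A) (V : S → ℝ) :
    ∑ s, visitation γ ρ π p s * (V s - γ * stepMean π p (fun _ _ s' => V s') s) =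
      (1 - γ) * ∑ s, ρ.1 s * V s := by
  set W : S → ℝ := stepMean π p fun _ _ s' => V s'
  have h1 := sum_visitation_mul hγ0 hγ1 ρ π p V
  have h2 := sum_visitation_mul hγ0 hγ1 ρ π p W
  have h3 := (summable_stateProb_mul hγ0 hγ1 ρ π p V).tsum_eq_zero_add
  have h4 : ∑' l, γ ^ (l + 1) * ∑ s, stateProb ρ π p (l + 1) s * V s =
      γ * ∑' l, γ ^ l * ∑ s, stateProb ρ π p l s * W s := by
    rw [← tsum_mul_left]
    exact tsum_congr fun l => by rw [sum_stateProb_succ, pow_succ]; ring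
  simp only [mul_sub, Finset.sum_sub_distrib, mul_left_comm _ γ, ← Finset.mul_sum]
  rw [h1, h2, h3, h4]
  simp only [stateProb, pow_zero]
  ring

theorem sum_visitation {γ : ℝ} (hγ0 : 0 < γ) (hγ1 : γ < 1) (ρ : stdSimplex ℝ S)
    (π : Policy S A) (p : TransKernel S A) : ∑ s, visitation γ ρ π p s = 1 := by
  have h := sum_visitation_flow hγ0 hγ1 ρ π p fun _ => 1
  simp only [stepMean, mul_one, simplex_sum, ← Finset.sum_mul] at h
  have : 1 - γ ≠ 0 := by linarith
  field_simp at h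
  linarith

theorem mul_le_visitation {γ : ℝ} (hγ0 : 0 < γ) (hγ1 : γ < 1) (ρ : stdSimplex ℝ S)
    (π : Policy S A) (p : TransKernel S A) (s : S) :
    (1 - γ) * ρ.1 s ≤ visitation γ ρ π p s := by
  refine mul_le_mul_of_nonneg_left ?_ (by linarith)
  have := (summable_stateProb hγ0 hγ1 ρ π p s).le_tsum 0 fun l _ =>
    mul_nonneg (pow_pos hγ0 l).le (stateProb_nonneg ρ π p l s)
  simpa [stateProb] using this

theorem visitation_nonneg {γ : ℝ} (hγ0 : 0 < γ) (hγ1 : γ < 1) (ρ : stdSimplex ℝ S)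
    (π : Policy S A) (p : TransKernel S A) (s : S) : 0 ≤ visitation γ ρ π p s :=
  (mul_nonneg (by linarith) (simplex_nonneg ρ s)).trans (mul_le_visitation hγ0 hγ1 ρ π p s)

theorem visitation_pos {γ : ℝ} (hγ0 : 0 < γ) (hγ1 : γ < 1) {ρ : stdSimplex ℝ S}
    (hρ : ∀ s, 0 < ρ.1 s) (π : Policy S A) (p : TransKernel S A) (s : S) :
    0 < visitation γ ρ π p s :=
  (mul_pos (by linarith) (hρ s)).trans_le (mul_le_visitation hγ0 hγ1 ρ π p s)

theorem visitation_le_one {γ : ℝ} (hγ0 : 0 < γ) (hγ1 : γ < 1) (ρ : stdSimplex ℝ S)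
    (π : Policy S A) (p : TransKernel S A) (s : S) : visitation γ ρ π p s ≤ 1 := by
  rw [← sum_visitation hγ0 hγ1 ρ π p]
  exact Finset.single_le_sum (fun s _ => visitation_nonneg hγ0 hγ1 ρ π p s) (Finset.mem_univ s)

/-- The visitation distribution as a point of the simplex. -/
noncomputable def visitationLaw {γ : ℝ} (hγ0 : 0 < γ) (hγ1 : γ < 1) (ρ : stdSimplex ℝ S)
    (π : Policy S A) (p : TransKernel S A) : stdSimplex ℝ S :=
  ⟨visitation γ ρ π p, visitation_nonneg hγ0 hγ1 ρ π p, sum_visitation hγ0 hγ1 ρ π p⟩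

theorem one_sub_mul_value {γ : ℝ} (hγ0 : 0 < γ) (hγ1 : γ < 1) (c : S → A → S → ℝ)
    (ρ : stdSimplex ℝ S) (π : Policy S A) (p : TransKernel S A) :
    (1 - γ) * value γ c ρ π p = ∑ s, visitation γ ρ π p s * stepMean π p c s := by
  rw [sum_visitation_mul hγ0 hγ1, value]
  simp only [stepMean, Finset.mul_sum, mul_assoc]

theorem abs_value_le {γ : ℝ} (hγ0 : 0 < γ) (hγ1 : γ < 1) {c : S → A → S → ℝ} {C : ℝ}
    (hc : ∀ s a s', |c s a s'| ≤ C) (ρ : stdSimplex ℝ S) (π : Policy S A) (p : TransKernel S A) :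
    |value γ c ρ π p| ≤ C / (1 - γ) := by
  have h := abs_sum_simplex_mul_le (visitationLaw hγ0 hγ1 ρ π p) (abs_stepMean_le π p hc)
  have h1 : 0 < 1 - γ := by linarith
  rw [show ∑ s, (visitationLaw hγ0 hγ1 ρ π p).1 s * stepMean π p c s =
    (1 - γ) * value γ c ρ π p from (one_sub_mul_value hγ0 hγ1 c ρ π p).symm, abs_mul,
    abs_of_pos h1] at h
  rw [le_div_iff₀ h1]
  linarith

/-- The expected cost of the `l`-th transition of a trajectory whose first transition is the given
one. -/
def laterCost (c : S → A → S → ℝ) (π : Policy S A) (p : TransKernel S A) :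
    ℕ → S → A → S → ℝ
  | 0 => c
  | l + 1 => fun _ _ s' => stepMean π p (laterCost c π p l) s'

/-- The action next-state value function `G(s, a, s')`: the expected discounted cost of a trajectory
whose first transition is `(s, a, s')`. -/
noncomputable def nextValue (γ : ℝ) (c : S → A → S → ℝ) (π : Policy S A) (p : TransKernel S A) :
    S → A → S → ℝ :=
  fun s a s' => ∑' l, γ ^ l * laterCost c π p l s a s'

theorem abs_laterCost_le {c : S → A → S → ℝ} {C : ℝ} (hc : ∀ s a s', |c s a s'| ≤ C)
    (π : Policy S A) (p : TransKernel S A) (l : ℕ) (s : S) (a : A) (s' : S) :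
    |laterCost c π p l s a s'| ≤ C := by
  induction l generalizing s a s' with
  | zero => exact hc s a s'
  | succ l ih => exact abs_stepMean_le π p ih s'

theorem abs_nextValue_sub_sum_range_le {γ : ℝ} (hγ0 : 0 < γ) (hγ1 : γ < 1) {c : S → A → S → ℝ}
    {C : ℝ} (hc : ∀ s a s', |c s a s'| ≤ C) (π : Policy S A) (p : TransKernel S A) (H : ℕ)
    (s : S) (a : A) (s' : S) :
    |nextValue γ c π p s a s' - ∑ l ∈ Finset.range H, γ ^ l * laterCost c π p l s a s'| ≤
      γ ^ H * (C / (1 - γ)) := by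
  have hs := summable_discounted hγ0 hγ1 fun l => abs_laterCost_le hc π p l s a s'
  rw [nextValue, ← hs.sum_add_tsum_nat_add H, add_sub_cancel_left]
  have : ∀ l, γ ^ (l + H) * laterCost c π p (l + H) s a s' =
      γ ^ H * (γ ^ l * laterCost c π p (l + H) s a s') := fun l => by rw [pow_add]; ring
  simp only [this]
  rw [tsum_mul_left, abs_mul, abs_of_pos (pow_pos hγ0 H)]
  exact mul_le_mul_of_nonneg_left
    (abs_tsum_discounted_le hγ0 hγ1 fun l => abs_laterCost_le hc π p (l + H) s a s')
    (pow_pos hγ0 H).le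

/-- The Bellman equation of the action next-state value function. -/
theorem nextValue_eq {γ : ℝ} (hγ0 : 0 < γ) (hγ1 : γ < 1) (c : S → A → S → ℝ)
    (π : Policy S A) (p : TransKernel S A) :
    nextValue γ c π p =
      c + γ • fun (_ : S) (_ : A) s' => stepMean π p (nextValue γ c π p) s' := by
  have hc : ∀ s a s', |c s a s'| ≤ ‖c‖ := fun s a s' =>
    (norm_le_pi_norm (c s a) s').trans ((norm_le_pi_norm (c s) a).trans (norm_le_pi_norm c s))
  have hs := fun s a s' => summable_discounted hγ0 hγ1 fun l => abs_laterCost_le hc π p l s a s'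
  have key : ∀ s', stepMean π p (nextValue γ c π p) s' =
      ∑' l, γ ^ l * stepMean π p (laterCost c π p l) s' := by
    intro s
    have h1 : ∀ a, ∑ s', (p s a).1 s' * nextValue γ c π p s a s' =
        ∑' l, ∑ s', (p s a).1 s' * (γ ^ l * laterCost c π p l s a s') := fun a => by
      rw [Summable.tsum_finsetSum fun s' _ => (hs s a s').mul_left _]
      simp only [tsum_mul_left, nextValue]
    have h2 : ∀ a, Summable fun l => ∑ s', (p s a).1 s' * (γ ^ l * laterCost c π p l s a s') :=
      fun a => summable_sum fun s' _ => (hs s a s').mul_left _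
    simp only [stepMean, h1, ← tsum_mul_left]
    rw [← Summable.tsum_finsetSum fun a _ => (h2 a).mul_left _]
    refine tsum_congr fun l => ?_
    simp only [Finset.mul_sum]
    exact Finset.sum_congr rfl fun a _ => Finset.sum_congr rfl fun s' _ => by ring
  funext s a s'
  simp only [Pi.add_apply, Pi.smul_apply, smul_eq_mul, key]
  rw [nextValue, (hs s a s').tsum_eq_zero_add, ← tsum_mul_left]
  simp only [laterCost, pow_zero, one_mul, pow_succ]
  congr 1
  exact tsum_congr fun l => by ring

/-- The performance difference identity: the gap between the values of two kernels is the mean, over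
the visitation distribution of the first, of the one-step advantage with respect to the second. -/
theorem performance_difference {γ : ℝ} (hγ0 : 0 < γ) (hγ1 : γ < 1) (c : S → A → S → ℝ)
    (ρ : stdSimplex ℝ S) (π : Policy S A) (p q : TransKernel S A) :
    ∑ s, visitation γ ρ π q s *
        (stepMean π q (nextValue γ c π p) s - stepMean π p (nextValue γ c π p) s) =
      (1 - γ) * (value γ c ρ π q - value γ c ρ π p) := by
  set G := nextValue γ c π p
  set V : S → ℝ := stepMean π p G
  have hG : ∀ r s, stepMean π r G s =
      stepMean π r c s + γ * stepMean π r (fun _ _ s' => V s') s := fun r s => by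
    rw [show G = _ from nextValue_eq hγ0 hγ1 c π p, stepMean_add, stepMean_smul]
  have hq := sum_visitation_flow hγ0 hγ1 ρ π q V
  have hp := sum_visitation_flow hγ0 hγ1 ρ π p V
  have hvq := one_sub_mul_value hγ0 hγ1 c ρ π q
  have hvp := one_sub_mul_value hγ0 hγ1 c ρ π p
  have e1 : ∑ s, visitation γ ρ π p s * (V s - γ * stepMean π p (fun _ _ s' => V s') s) =
      ∑ s, visitation γ ρ π p s * stepMean π p c s :=
    Finset.sum_congr rfl fun s _ => by rw [show V s = _ from hG p s]; ring
  have e2 : ∑ s, visitation γ ρ π q s * (stepMean π q G s - V s) =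
      ∑ s, visitation γ ρ π q s * stepMean π q c s -
        ∑ s, visitation γ ρ π q s * (V s - γ * stepMean π q (fun _ _ s' => V s') s) := by
    rw [← Finset.sum_sub_distrib]
    exact Finset.sum_congr rfl fun s _ => by rw [hG q s]; ring
  linarith

/-! ### Bregman divergences and the proximal step -/

/-- The gradient inequality for a convex function that is differentiable within its domain. -/
theorem fderivWithin_sub_le_of_convexOn {E : Type*} [NormedAddCommGroup E] [NormedSpace ℝ E]
    {K : Set E} {h : E → ℝ} (hh : ConvexOn ℝ K h) {x y : E} (hx : x ∈ K) (hy : y ∈ K)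
    (hd : DifferentiableWithinAt ℝ h K y) : fderivWithin ℝ h K y (x - y) ≤ h x - h y := by
  set φ : ℝ →ᵃ[ℝ] E := AffineMap.lineMap y x
  have h0 : φ 0 = y := AffineMap.lineMap_apply_zero y x
  have h1 : φ 1 = x := AffineMap.lineMap_apply_one y x
  have hφ : HasDerivWithinAt φ (x - y) (φ ⁻¹' K) 0 := AffineMap.hasDerivWithinAt_lineMap
  have hder : HasDerivWithinAt (h ∘ φ) (fderivWithin ℝ h K y (x - y)) (φ ⁻¹' K) 0 := by
    refine HasFDerivWithinAt.comp_hasDerivWithinAt 0 ?_ hφ (Set.mapsTo_preimage φ K)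
    rw [h0]
    exact hd.hasFDerivWithinAt
  have := (hh.comp_affineMap φ).le_slope_of_hasDerivWithinAt (x := 0) (y := 1)
    (by simpa only [Set.mem_preimage, h0] using hy) (by simpa only [Set.mem_preimage, h1] using hx)
    one_pos hder
  simpa [slope_def_field, h0, h1] using this

theorem bregman_nonneg {K : Set (A → S → ℝ)} {h : (A → S → ℝ) → ℝ} (hh : ConvexOn ℝ K h)
    {x y : A → S → ℝ} (hx : x ∈ K) (hy : y ∈ K) (hd : DifferentiableWithinAt ℝ h K y) :
    0 ≤ bregman K h x y := by
  have := fderivWithin_sub_le_of_convexOn hh hx hy hd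
  unfold bregman
  linarith

/-- The linear functional `z ↦ ⟨g, z⟩`. -/
def pairing (g : A → S → ℝ) : (A → S → ℝ) →L[ℝ] ℝ :=
  ∑ a, ∑ s', g a s' • (ContinuousLinearMap.proj s' : (S → ℝ) →L[ℝ] ℝ).comp
    (ContinuousLinearMap.proj a : (A → S → ℝ) →L[ℝ] (S → ℝ))

theorem pairing_apply (g z : A → S → ℝ) : pairing g z = ∑ a, ∑ s', g a s' * z a s' := by
  simp [pairing]

/-- The three-point inequality of mirror ascent: first-order optimality of the proximal point `x`
in the direction of `u`, rewritten by means of Bregman divergences. -/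
theorem bregman_three_point {K : Set (A → S → ℝ)} {h : (A → S → ℝ) → ℝ}
    (hh : IsDistanceGenerating K h) {g x y u : A → S → ℝ} (hx : x ∈ K) (hy : y ∈ K) (hu : u ∈ K)
    (hd : DifferentiableWithinAt ℝ h K y)
    (hmax : IsMaxOn (fun z => ∑ a, ∑ s', g a s' * z a s' - bregman K h z y) K x) :
    pairing g u - pairing g x ≤ bregman K h u y - bregman K h u x - bregman K h x y := by
  have hdx : DifferentiableWithinAt ℝ h K x := hh.2 y hy hd g x hx hmax
  set h' := fderivWithin ℝ h K x with hh'
  set k' := fderivWithin ℝ h K y with hk'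
  have hder : HasFDerivWithinAt
      (fun z => ∑ a, ∑ s', g a s' * z a s' - bregman K h z y) (pairing g - (h' - k')) K x := by
    simp only [← pairing_apply, bregman]
    refine (pairing g).hasFDerivWithinAt.sub ((hdx.hasFDerivWithinAt.sub_const (h y)).sub ?_)
    simp only [map_sub]
    exact k'.hasFDerivWithinAt.sub_const _
  have hle := hmax.localize.hasFDerivWithinAt_nonpos hder
    (sub_mem_posTangentConeAt_of_segment_subset (hh.1.1.segment_subset hx hu))
  simp only [sub_apply, map_sub] at hle
  simp only [bregman, ← hh', ← hk', map_sub]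
  linarith

theorem pairing_block (π : Policy S A) (q : TransKernel S A) (r : ℝ) (F : S → A → S → ℝ) (s : S) :
    pairing (fun a s' => r * ((π s).1 a * F s a s')) (block q s) = r * stepMean π q F s := by
  simp only [pairing_apply, stepMean, block, Finset.mul_sum]
  exact Finset.sum_congr rfl fun a _ => Finset.sum_congr rfl fun s' _ => by ring

/-- The mirror ascent objective splits over the states. -/
theorem tmaObjective_eq (γ : ℝ) (ρ : stdSimplex ℝ S) (π : Policy S A) (U : S → Set (A → S → ℝ))
    (h : S → (A → S → ℝ) → ℝ) (η : ℝ) {α : ℝ} (hα : 0 < α) (p : TransKernel S A)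
    (Ghat : S → A → S → ℝ) (q : TransKernel S A) :
    tmaObjective γ ρ π U h η α p Ghat q =
      ∑ s, α * visitation γ ρ π p s *
        (pairing (fun a s' => η / α * ((π s).1 a * Ghat s a s')) (block q s) -
          bregman (U s) (h s) (block q s) (block p s)) := by
  have h1 : ∀ s, ∑ a, visitation γ ρ π p s * (π s).1 a * ∑ s', (q s a).1 s' * Ghat s a s' =
      visitation γ ρ π p s * stepMean π q Ghat s := fun s => by
    simp only [stepMean, Finset.mul_sum, mul_assoc]
  simp only [tmaObjective, weightedBregman, pairing_block, h1]
  rw [Finset.mul_sum, Finset.mul_sum, ← Finset.sum_sub_distrib]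
  refine Finset.sum_congr rfl fun s _ => ?_
  field_simp

theorem isMaxOn_block [DecidableEq S] {γ : ℝ} (hγ0 : 0 < γ) (hγ1 : γ < 1) {ρ : stdSimplex ℝ S}
    (hρ : ∀ s, 0 < ρ.1 s) (π : Policy S A) {U : S → Set (A → S → ℝ)}
    (hU : ∀ s, ∀ k ∈ U s, ∀ a, k a ∈ stdSimplex ℝ S) (h : S → (A → S → ℝ) → ℝ) {η α : ℝ}
    (hα : 0 < α) (p : TransKernel S A) (Ghat : S → A → S → ℝ) {q : TransKernel S A}
    (hq : q ∈ rectSet U) (hmax : IsMaxOn (tmaObjective γ ρ π U h η α p Ghat) (rectSet U) q)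
    (s : S) :
    IsMaxOn (fun z => ∑ a, ∑ s', η / α * ((π s).1 a * Ghat s a s') * z a s' -
      bregman (U s) (h s) z (block p s)) (U s) (block q s) := by
  intro z hz
  -- compare `q` with the kernel whose block at `s` is replaced by `z`
  set r : TransKernel S A := Function.update q s fun a => ⟨z a, hU s z hz a⟩ with hr
  have hrs : block r s = z := by
    funext a s'
    simp [block, hr]
  have hrt : ∀ t, t ≠ s → block r t = block q t := fun t ht => by
    funext a s'
    simp [block, hr, Function.update_of_ne ht]
  have hrU : r ∈ rectSet U := fun t => by
    rcases eq_or_ne t s with rfl | ht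
    · rwa [hrs]
    · rw [hrt t ht]
      exact hq t
  have hle : tmaObjective γ ρ π U h η α p Ghat r ≤ tmaObjective γ ρ π U h η α p Ghat q :=
    hmax hrU
  rw [tmaObjective_eq _ _ _ _ _ _ hα, tmaObjective_eq _ _ _ _ _ _ hα, ← sub_nonneg,
    ← Finset.sum_sub_distrib,
    Finset.sum_eq_single s (fun t _ ht => by rw [hrt t ht, sub_self]) (by simp), ← mul_sub,
    hrs] at hle
  have := nonneg_of_mul_nonneg_right hle (mul_pos hα (visitation_pos hγ0 hγ1 hρ π p s))
  simp only [Set.mem_ofPred_eq, ← pairing_apply]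
  linarith

/-! ### Mismatch coefficient and density ratio -/

theorem visitation_le_densityRatio_mul {γ : ℝ} (hγ0 : 0 < γ) (hγ1 : γ < 1) {ρ : stdSimplex ℝ S}
    (hρ : ∀ s, 0 < ρ.1 s) (π : Policy S A) {P : Set (TransKernel S A)} (pstar : TransKernel S A)
    {p : TransKernel S A} (hp : p ∈ P) (s : S) :
    visitation γ ρ π pstar s ≤ densityRatio γ ρ π P pstar * visitation γ ρ π p s := by
  have hb : BddAbove (Set.range fun p : P =>
      ⨆ s, visitation γ ρ π pstar s / visitation γ ρ π p.1 s) := by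
    refine ⟨⨆ s, 1 / ((1 - γ) * ρ.1 s), ?_⟩
    rintro _ ⟨q, rfl⟩
    refine ciSup_mono (Set.finite_range _).bddAbove fun s => ?_
    exact div_le_div₀ zero_le_one (visitation_le_one hγ0 hγ1 ρ π pstar s)
      (mul_pos (by linarith) (hρ s)) (mul_le_visitation hγ0 hγ1 ρ π q.1 s)
  rw [← div_le_iff₀ (visitation_pos hγ0 hγ1 hρ π p s)]
  exact (le_ciSup (f := fun s => visitation γ ρ π pstar s / visitation γ ρ π p s)
    (Set.finite_range _).bddAbove s).trans (le_ciSup hb ⟨p, hp⟩)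

theorem visitation_div_le_mismatch {γ : ℝ} (hγ0 : 0 < γ) (hγ1 : γ < 1) {ρ : stdSimplex ℝ S}
    (hρ : ∀ s, 0 < ρ.1 s) {Pol : Set (Policy S A)} {π : Policy S A} (hπ : π ∈ Pol)
    {P : Set (TransKernel S A)} {p : TransKernel S A} (hp : p ∈ P) (s : S) :
    visitation γ ρ π p s / ρ.1 s ≤ mismatch γ ρ Pol P := by
  have hb : BddAbove (Set.range fun x : Pol × P => ⨆ s, visitation γ ρ x.1.1 x.2.1 s / ρ.1 s) := by
    refine ⟨⨆ s, 1 / ρ.1 s, ?_⟩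
    rintro _ ⟨q, rfl⟩
    refine ciSup_mono (Set.finite_range _).bddAbove fun s => ?_
    exact div_le_div_of_nonneg_right (visitation_le_one hγ0 hγ1 ρ _ _ s) (hρ s).le
  exact (le_ciSup (f := fun s => visitation γ ρ π p s / ρ.1 s)
    (Set.finite_range _).bddAbove s).trans (le_ciSup hb (⟨π, hπ⟩, ⟨p, hp⟩))

/-- Both distributions have mass one, so some ratio is at least one. -/
theorem one_le_mismatch {γ : ℝ} (hγ0 : 0 < γ) (hγ1 : γ < 1) {ρ : stdSimplex ℝ S}
    (hρ : ∀ s, 0 < ρ.1 s) {Pol : Set (Policy S A)} {π : Policy S A} (hπ : π ∈ Pol)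
    {P : Set (TransKernel S A)} {p : TransKernel S A} (hp : p ∈ P) :
    1 ≤ mismatch γ ρ Pol P := by
  have h : ∑ s, visitation γ ρ π p s ≤ ∑ s, mismatch γ ρ Pol P * ρ.1 s :=
    Finset.sum_le_sum fun s _ =>
      (div_le_iff₀ (hρ s)).1 (visitation_div_le_mismatch hγ0 hγ1 hρ hπ hp s)
  rwa [sum_visitation hγ0 hγ1, ← Finset.mul_sum, simplex_sum, mul_one] at h

theorem densityRatio_le_mismatch_div [Nonempty S] {γ : ℝ} (hγ0 : 0 < γ) (hγ1 : γ < 1)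
    {ρ : stdSimplex ℝ S} (hρ : ∀ s, 0 < ρ.1 s) {Pol : Set (Policy S A)} {π : Policy S A}
    (hπ : π ∈ Pol) {P : Set (TransKernel S A)} {pstar : TransKernel S A} (hp : pstar ∈ P) :
    densityRatio γ ρ π P pstar ≤ mismatch γ ρ Pol P / (1 - γ) := by
  have : Nonempty P := ⟨⟨pstar, hp⟩⟩
  have h1 : 0 < 1 - γ := by linarith
  refine ciSup_le fun q => ciSup_le fun s => ?_
  calc visitation γ ρ π pstar s / visitation γ ρ π q.1 s
      ≤ visitation γ ρ π pstar s / ((1 - γ) * ρ.1 s) :=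
        div_le_div_of_nonneg_left (visitation_nonneg hγ0 hγ1 ρ π pstar s)
          (mul_pos h1 (hρ s)) (mul_le_visitation hγ0 hγ1 ρ π q.1 s)
    _ = visitation γ ρ π pstar s / ρ.1 s / (1 - γ) := by rw [div_div, mul_comm]
    _ ≤ _ := div_le_div_of_nonneg_right (visitation_div_le_mismatch hγ0 hγ1 hρ hπ hp s) h1.le

/-! ### Contraction of the optimality gap -/

theorem weightedBregman_nonneg {U : S → Set (A → S → ℝ)} {h : S → (A → S → ℝ) → ℝ}
    (hh : ∀ s, IsDistanceGenerating (U s) (h s)) {w : S → ℝ} (hw : ∀ s, 0 ≤ w s)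
    {q p : TransKernel S A} (hq : q ∈ rectSet U) (hp : p ∈ rectSet U)
    (hd : ∀ s, DifferentiableWithinAt ℝ (h s) (U s) (block p s)) :
    0 ≤ weightedBregman U h w q p :=
  Finset.sum_nonneg fun s _ =>
    mul_nonneg (hw s) (bregman_nonneg (hh s).1 (hq s) (hp s) (hd s))

/-- A mirror ascent step with an estimate of uniform accuracy `e`. The three-point inequality is
used at each state, once with the worst-case kernel and once with the current one as comparison
point. In the second use the advantage of the new kernel is nonnegative at every state, which allows
the weights `d^{π,p*}` to be replaced by `M d^{π,q}`, for which the performance difference identity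
evaluates the sum. -/
theorem tma_step [DecidableEq S] {γ : ℝ} (hγ0 : 0 < γ) (hγ1 : γ < 1) {c : S → A → S → ℝ}
    {ρ : stdSimplex ℝ S} (hρ : ∀ s, 0 < ρ.1 s) {π : Policy S A} {U : S → Set (A → S → ℝ)}
    (hU : ∀ s, ∀ k ∈ U s, ∀ a, k a ∈ stdSimplex ℝ S) {h : S → (A → S → ℝ) → ℝ}
    (hh : ∀ s, IsDistanceGenerating (U s) (h s)) {pstar : TransKernel S A}
    (hpstar : pstar ∈ rectSet U) {η α : ℝ} (hη : 0 < η) (hα : 0 < α) {M : ℝ} (hM0 : 0 ≤ M)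
    (hM : densityRatio γ ρ π (rectSet U) pstar ≤ M) {p q : TransKernel S A} (hp : p ∈ rectSet U)
    (hd : ∀ s, DifferentiableWithinAt ℝ (h s) (U s) (block p s)) {Ghat : S → A → S → ℝ}
    (hq : q ∈ rectSet U) (hmax : IsMaxOn (tmaObjective γ ρ π U h η α p Ghat) (rectSet U) q)
    {e : ℝ} (he : ∀ s a s', |Ghat s a s' - nextValue γ c π p s a s'| ≤ e) :
    (∀ s, DifferentiableWithinAt ℝ (h s) (U s) (block q s)) ∧
      M * ((1 - γ) * (value γ c ρ π pstar - value γ c ρ π q)) +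
          α / η * weightedBregman U h (visitation γ ρ π pstar) pstar q ≤
        (M - 1) * ((1 - γ) * (value γ c ρ π pstar - value γ c ρ π p)) +
          α / η * weightedBregman U h (visitation γ ρ π pstar) pstar p + 2 * e * (M + 1) := by
  have hblock := isMaxOn_block hγ0 hγ1 hρ π hU h (η := η) hα p Ghat hq hmax
  have hdq : ∀ s, DifferentiableWithinAt ℝ (h s) (U s) (block q s) := fun s =>
    (hh s).2 _ (hp s) (hd s) _ _ (hq s) (hblock s)
  refine ⟨hdq, ?_⟩
  have h3 : ∀ r ∈ rectSet U, ∀ s, stepMean π r Ghat s - stepMean π q Ghat s ≤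
      α / η * (bregman (U s) (h s) (block r s) (block p s) -
        bregman (U s) (h s) (block r s) (block q s) -
        bregman (U s) (h s) (block q s) (block p s)) := fun r hr s => by
    have := bregman_three_point (hh s) (hq s) (hp s) (hr s) (hd s) (hblock s)
    rw [pairing_block, pairing_block, ← mul_sub] at this
    calc stepMean π r Ghat s - stepMean π q Ghat s
        = α / η * (η / α * (stepMean π r Ghat s - stepMean π q Ghat s)) := by field_simp
      _ ≤ _ := mul_le_mul_of_nonneg_left this (div_pos hα hη).le
  have hαη : 0 < α / η := div_pos hα hη
  set G := nextValue γ c π p with hG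
  set d := visitation γ ρ π pstar with hd'
  set d' := visitation γ ρ π q with hd''
  -- the estimated advantage of `r` over the current kernel
  set adv : TransKernel S A → S → ℝ := fun r s => stepMean π r Ghat s - stepMean π p Ghat s
    with hadv
  have hadv_err : ∀ r s, |adv r s - (stepMean π r G s - stepMean π p G s)| ≤ 2 * e := fun r s => by
    have h1 := abs_stepMean_le π r (F := Ghat - G) he s
    have h2 := abs_stepMean_le π p (F := Ghat - G) he s
    rw [stepMean_sub] at h1 h2
    rw [abs_le] at *
    constructor <;> simp only [hadv] <;> linarith [h1.1, h1.2, h2.1, h2.2]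
  have hmean : ∀ r t : TransKernel S A,
      |∑ s, visitation γ ρ π t s * (adv r s - (stepMean π r G s - stepMean π p G s))| ≤ 2 * e :=
    fun r t => abs_sum_simplex_mul_le (visitationLaw hγ0 hγ1 ρ π t) (hadv_err r)
  have hsplit : ∀ r t : TransKernel S A,
      ∑ s, visitation γ ρ π t s * (adv r s - (stepMean π r G s - stepMean π p G s)) =
        ∑ s, visitation γ ρ π t s * adv r s -
          ∑ s, visitation γ ρ π t s * (stepMean π r G s - stepMean π p G s) := fun r t => by
    rw [← Finset.sum_sub_distrib]
    exact Finset.sum_congr rfl fun s _ => by ring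
  have hA := hmean pstar pstar
  rw [hsplit, performance_difference hγ0 hγ1, abs_le] at hA
  have hB := hmean q q
  rw [hsplit, performance_difference hγ0 hγ1, abs_le] at hB
  have hq_nonneg : ∀ s, 0 ≤ adv q s := fun s => by
    have h4 := h3 p hp s
    have h5 := bregman_nonneg (hh s).1 (hq s) (hp s) (hd s)
    have h6 := bregman_nonneg (hh s).1 (hp s) (hq s) (hdq s)
    have h7 : bregman (U s) (h s) (block p s) (block p s) = 0 := by simp [bregman]
    have h8 : α / η * (bregman (U s) (h s) (block p s) (block p s) -
        bregman (U s) (h s) (block p s) (block q s) -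
        bregman (U s) (h s) (block q s) (block p s)) ≤ 0 :=
      mul_nonpos_of_nonneg_of_nonpos hαη.le (by linarith)
    simp only [hadv]
    linarith
  have hC : ∑ s, d s * adv q s ≤ M * ∑ s, d' s * adv q s := by
    rw [Finset.mul_sum]
    refine Finset.sum_le_sum fun s _ => ?_
    rw [← mul_assoc]
    refine mul_le_mul_of_nonneg_right ?_ (hq_nonneg s)
    exact (visitation_le_densityRatio_mul hγ0 hγ1 hρ π pstar hq s).trans
      (mul_le_mul_of_nonneg_right hM (visitation_nonneg hγ0 hγ1 ρ π q s))
  have hD : ∑ s, d s * adv pstar s - ∑ s, d s * adv q s ≤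
      α / η * weightedBregman U h d pstar p - α / η * weightedBregman U h d pstar q := by
    rw [← mul_sub]
    simp only [weightedBregman]
    rw [← Finset.sum_sub_distrib, ← Finset.sum_sub_distrib, Finset.mul_sum]
    refine Finset.sum_le_sum fun s _ => ?_
    have h5 := bregman_nonneg (hh s).1 (hq s) (hp s) (hd s)
    have h6 : adv pstar s - adv q s ≤ α / η * (bregman (U s) (h s) (block pstar s) (block p s) -
        bregman (U s) (h s) (block pstar s) (block q s)) := by
      have h8 := mul_nonneg hαη.le h5
      have h9 := h3 pstar hpstar s
      rw [mul_sub] at h9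
      simp only [hadv]
      linarith
    have h7 := mul_le_mul_of_nonneg_left h6 (visitation_nonneg hγ0 hγ1 ρ π pstar s)
    calc d s * adv pstar s - d s * adv q s = d s * (adv pstar s - adv q s) := by ring
      _ ≤ _ := h7
      _ = _ := by simp only [hd']; ring
  have hE := mul_le_mul_of_nonneg_left hB.2 hM0
  linarith [hA.1]

/-- The invariant of approximate TMA after `t` iterations, for estimates of uniform accuracy `e`:
the kernel is admissible, the generators are differentiable there, and the optimality gap together
with a multiple of the divergence from the worst-case kernel has contracted. The multiple involves
`γ η(t)`, which is the step size of the previous iteration. -/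
def IsGood (γ : ℝ) (c : S → A → S → ℝ) (C : ℝ) (ρ : stdSimplex ℝ S) (π : Policy S A)
    (U : S → Set (A → S → ℝ)) (h : S → (A → S → ℝ) → ℝ) (pstar : TransKernel S A)
    (η : ℕ → ℝ) (α M e : ℝ) (t : ℕ) (p : TransKernel S A) : Prop :=
  p ∈ rectSet U ∧ (∀ s, DifferentiableWithinAt ℝ (h s) (U s) (block p s)) ∧
    (1 - γ) * (value γ c ρ π pstar - value γ c ρ π p) +
        α / (M * (γ * η t)) * weightedBregman U h (visitation γ ρ π pstar) pstar p ≤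
      (1 - 1 / M) ^ t * (3 * C) + 2 * e * (M + 1)

theorem isGood_zero {γ : ℝ} (hγ0 : 0 < γ) (hγ1 : γ < 1) {c : S → A → S → ℝ} {C : ℝ}
    (hC : 0 < C) (hc : ∀ s a s', |c s a s'| ≤ C) {ρ : stdSimplex ℝ S} {π : Policy S A}
    {U : S → Set (A → S → ℝ)} {h : S → (A → S → ℝ) → ℝ} {pstar p0 : TransKernel S A}
    (hp0 : p0 ∈ rectSet U)
    (hp0d : ∀ s, DifferentiableWithinAt ℝ (h s) (U s) (block p0 s)) {α : ℝ} {η : ℕ → ℝ}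
    (hη0 : 0 < η 0)
    (hη : α / C * ((1 - γ) / γ) *
      weightedBregman U h (visitation γ ρ π pstar) pstar p0 ≤ η 0)
    {M e : ℝ} (hM : 1 / (1 - γ) ≤ M) (he : 0 ≤ e) :
    IsGood γ c C ρ π U h pstar η α M e 0 p0 := by
  have h1 : 0 < 1 - γ := by linarith
  have hM0 : 0 < M := (one_div_pos.2 h1).trans_le hM
  refine ⟨hp0, hp0d, ?_⟩
  have hv1 := abs_le.1 (abs_value_le hγ0 hγ1 hc ρ π pstar)
  have hv2 := abs_le.1 (abs_value_le hγ0 hγ1 hc ρ π p0)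
  have hgap : (1 - γ) * (value γ c ρ π pstar - value γ c ρ π p0) ≤ 2 * C := by
    calc _ ≤ (1 - γ) * (2 * (C / (1 - γ))) :=
          mul_le_mul_of_nonneg_left (by linarith [hv1.2, hv2.1]) h1.le
      _ = 2 * C := by field_simp
  have hD : α / (M * (γ * η 0)) * weightedBregman U h (visitation γ ρ π pstar) pstar p0 ≤ C := by
    set D := weightedBregman U h (visitation γ ρ π pstar) pstar p0
    have e1 : α / (M * (γ * η 0)) * D =
        (α / C * ((1 - γ) / γ) * D) * (C / (M * (1 - γ) * η 0)) := by field_simp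
    have h2 : 1 ≤ M * (1 - γ) := (div_le_iff₀ h1).1 hM
    rw [e1]
    calc _ ≤ η 0 * (C / (M * (1 - γ) * η 0)) := mul_le_mul_of_nonneg_right hη (by positivity)
      _ = C / (M * (1 - γ)) := by field_simp
      _ ≤ C := div_le_self hC.le h2
  have : 0 ≤ 2 * e * (M + 1) := by positivity
  linarith

theorem IsGood.step [DecidableEq S] {γ : ℝ} (hγ0 : 0 < γ) (hγ1 : γ < 1) {c : S → A → S → ℝ} {C : ℝ}
    {ρ : stdSimplex ℝ S} (hρ : ∀ s, 0 < ρ.1 s) {π : Policy S A} {U : S → Set (A → S → ℝ)}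
    (hU : ∀ s, ∀ k ∈ U s, ∀ a, k a ∈ stdSimplex ℝ S) {h : S → (A → S → ℝ) → ℝ}
    (hh : ∀ s, IsDistanceGenerating (U s) (h s)) {pstar : TransKernel S A}
    (hpstar : pstar ∈ rectSet U) {α : ℝ} (hα : 0 < α) {η : ℕ → ℝ} (hηpos : ∀ t, 0 < η t)
    (hηs : ∀ t, η (t + 1) = η t / γ)
    {upd : ℕ → TransKernel S A → (S → A → S → ℝ) → TransKernel S A}
    (hupd : IsTMAUpdate γ ρ π U h η α upd) {M e : ℝ} (hM1 : 1 / (1 - γ) ≤ M)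
    (hM : densityRatio γ ρ π (rectSet U) pstar ≤ M) {t : ℕ} {p : TransKernel S A}
    (hp : IsGood γ c C ρ π U h pstar η α M e t p) {Ghat : S → A → S → ℝ}
    (he : ∀ s a s', |Ghat s a s' - nextValue γ c π p s a s'| ≤ e) :
    IsGood γ c C ρ π U h pstar η α M e (t + 1) (upd t p Ghat) := by
  have h1 : 0 < 1 - γ := by linarith
  have hM0 : 0 < M := (one_div_pos.2 h1).trans_le hM1
  obtain ⟨hpU, hpd, hpot⟩ := hp
  obtain ⟨hqU, hqmax⟩ := hupd t p Ghat hpU hpd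
  obtain ⟨hqd, hstep⟩ :=
    tma_step hγ0 hγ1 hρ hU hh hpstar (hηpos t) hα hM0.le hM hpU hpd hqU hqmax he
  refine ⟨hqU, hqd, ?_⟩
  set q := upd t p Ghat
  have hDp := weightedBregman_nonneg hh (visitation_nonneg hγ0 hγ1 ρ π pstar) hpstar hpU hpd
  set Dp := weightedBregman U h (visitation γ ρ π pstar) pstar p
  set Dq := weightedBregman U h (visitation γ ρ π pstar) pstar q
  set gp := (1 - γ) * (value γ c ρ π pstar - value γ c ρ π p)
  set gq := (1 - γ) * (value γ c ρ π pstar - value γ c ρ π q)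
  have hη := hηpos t
  -- the contraction factor dominates the discount factor
  have hγM : γ ≤ 1 - 1 / M := by
    have : 1 / M ≤ 1 - γ := (one_div_le h1 hM0).1 hM1
    linarith
  have e1 : α / (M * (γ * η (t + 1))) * Dq = α / η t * Dq / M := by
    rw [hηs]
    field_simp
  have e2 : α / η t * Dp / M = γ * (α / (M * (γ * η t)) * Dp) := by field_simp
  have hX : 0 ≤ α / (M * (γ * η t)) * Dp := by positivity
  have h2 : gq + α / η t * Dq / M ≤
      (1 - 1 / M) * gp + α / η t * Dp / M + 2 * e * (M + 1) / M := by
    have := div_le_div_of_nonneg_right hstep hM0.le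
    calc _ = (M * gq + α / η t * Dq) / M := by field_simp
      _ ≤ _ := this
      _ = _ := by field_simp
  have h3 := mul_le_mul_of_nonneg_right hγM hX
  have h4 := mul_le_mul_of_nonneg_left hpot (hγ0.le.trans hγM)
  have e3 : (1 - 1 / M) * ((1 - 1 / M) ^ t * (3 * C) + 2 * e * (M + 1)) + 2 * e * (M + 1) / M =
      (1 - 1 / M) ^ (t + 1) * (3 * C) + 2 * e * (M + 1) := by
    rw [pow_succ]
    ring
  rw [e1]
  linarith

theorem IsGood.gap_le {γ : ℝ} (hγ0 : 0 < γ) (hγ1 : γ < 1) {c : S → A → S → ℝ} {C : ℝ}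
    (hC : 0 < C) {ρ : stdSimplex ℝ S} {π : Policy S A} {U : S → Set (A → S → ℝ)}
    {h : S → (A → S → ℝ) → ℝ} (hh : ∀ s, IsDistanceGenerating (U s) (h s))
    {pstar : TransKernel S A} (hpstar : pstar ∈ rectSet U) {α : ℝ} (hα : 0 < α) {η : ℕ → ℝ}
    (hηpos : ∀ t, 0 < η t) {M e ε : ℝ} (hM : 1 < M) (hε : 0 < ε)
    (he : e = ε * (1 - γ) / (8 * M)) {T : ℕ}
    (hT : Real.logb (M / (M - 1)) (6 * C / (ε * (1 - γ))) ≤ T) {p : TransKernel S A}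
    (hp : IsGood γ c C ρ π U h pstar η α M e T p) :
    value γ c ρ π pstar - value γ c ρ π p ≤ ε := by
  have h1 : 0 < 1 - γ := by linarith
  have hM0 : 0 < M := by linarith
  have hM1 : 0 < M - 1 := by linarith
  obtain ⟨hpU, hpd, hpot⟩ := hp
  have hD := weightedBregman_nonneg hh (visitation_nonneg hγ0 hγ1 ρ π pstar) hpstar hpU hpd
  have hη := hηpos T
  have hX : 0 ≤ α / (M * (γ * η T)) * weightedBregman U h (visitation γ ρ π pstar) pstar p := by
    positivity
  have hb : 1 < M / (M - 1) := by
    rw [one_lt_div hM1]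
    linarith
  have hpow : (1 - 1 / M) ^ T * (3 * C) ≤ ε * (1 - γ) / 2 := by
    rw [Real.logb_le_iff_le_rpow hb (by positivity), Real.rpow_natCast,
      div_le_iff₀ (by positivity)] at hT
    have e1 : (1 - 1 / M) * (M / (M - 1)) = 1 := by field_simp
    have hM2 : 0 ≤ 1 - 1 / M := by
      rw [sub_nonneg, div_le_one hM0]
      exact hM.le
    calc (1 - 1 / M) ^ T * (3 * C) = (1 - 1 / M) ^ T * (6 * C) / 2 := by ring
      _ ≤ (1 - 1 / M) ^ T * ((M / (M - 1)) ^ T * (ε * (1 - γ))) / 2 := by gcongr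
      _ = ((1 - 1 / M) * (M / (M - 1))) ^ T * (ε * (1 - γ)) / 2 := by rw [mul_pow]; ring
      _ = _ := by rw [e1, one_pow, one_mul]
  have herr : 2 * e * (M + 1) ≤ ε * (1 - γ) / 2 := by
    calc 2 * e * (M + 1) ≤ 2 * e * (2 * M) := by
          have : 0 ≤ e := by rw [he]; positivity
          gcongr
          linarith
      _ = _ := by rw [he]; field_simp; ring
  have : (1 - γ) * (value γ c ρ π pstar - value γ c ρ π p) ≤ (1 - γ) * ε := by linarith
  exact le_of_mul_le_mul_left this h1

open MeasureTheory ProbabilityTheory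

/-! ### The mean of a sampled trajectory -/

/-- The mean of `F` under a probability mass function on a finite type. -/
def pmfMean {β : Type*} [Fintype β] (μ : PMF β) (F : β → ℝ) : ℝ := ∑ b, (μ b).toReal * F b

theorem sum_toReal_pmf {β : Type*} [Fintype β] (μ : PMF β) : ∑ b, (μ b).toReal = 1 := by
  rw [← ENNReal.toReal_sum fun b _ => μ.apply_ne_top b, ← tsum_fintype (L := .unconditional _),
    μ.tsum_coe, ENNReal.toReal_one]

theorem pmfMean_const_add_mul {β : Type*} [Fintype β] (μ : PMF β) (r t : ℝ) (F : β → ℝ) :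
    pmfMean μ (fun b => r + t * F b) = r + t * pmfMean μ F := by
  simp only [pmfMean, mul_add, Finset.sum_add_distrib, ← Finset.sum_mul, sum_toReal_pmf, one_mul,
    Finset.mul_sum]
  congr 1
  exact Finset.sum_congr rfl fun b _ => by ring

theorem pmfMean_bind {β β' : Type*} [Fintype β] [Fintype β'] (μ : PMF β) (f : β → PMF β')
    (F : β' → ℝ) : pmfMean (μ.bind f) F = pmfMean μ fun b => pmfMean (f b) F := by
  have h : ∀ b', ((μ.bind f) b').toReal = ∑ b, (μ b).toReal * (f b b').toReal := fun b' => by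
    rw [PMF.bind_apply, tsum_fintype, ENNReal.toReal_sum fun b _ =>
      ENNReal.mul_ne_top (μ.apply_ne_top b) ((f b).apply_ne_top b')]
    simp only [ENNReal.toReal_mul]
  simp only [pmfMean, h, Finset.sum_mul, Finset.mul_sum]
  rw [Finset.sum_comm]
  exact Finset.sum_congr rfl fun b _ => Finset.sum_congr rfl fun b' _ => by ring

theorem pmfMean_pure {β : Type*} [Fintype β] (b : β) (F : β → ℝ) :
    pmfMean (PMF.pure b) F = F b := by
  classical
  rw [pmfMean, Finset.sum_eq_single b]
  · simp
  · intro b' _ hb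
    simp [PMF.pure_apply, hb]
  · simp

theorem pmfMean_map {β β' : Type*} [Fintype β] [Fintype β'] (μ : PMF β) (g : β → β')
    (F : β' → ℝ) : pmfMean (μ.map g) F = pmfMean μ fun b => F (g b) := by
  rw [PMF.map, pmfMean_bind]
  simp only [Function.comp_apply, pmfMean_pure]

theorem pmfMean_toPMF {β : Type*} [Fintype β] (v : stdSimplex ℝ β) (F : β → ℝ) :
    pmfMean (toPMF v) F = ∑ b, v.1 b * F b := by
  simp only [pmfMean, toPMF, PMF.ofFintype_apply, ENNReal.toReal_ofReal (simplex_nonneg v _)]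

/-- The discounted cost of a finite trajectory. -/
def trajCost (γ : ℝ) (c : S → A → S → ℝ) {H : ℕ} (τ : Fin H → S × A × S) : ℝ :=
  ∑ l : Fin H, γ ^ (l : ℕ) * c (τ l).1 (τ l).2.1 (τ l).2.2

theorem sum_range_laterCost_succ (γ : ℝ) (c : S → A → S → ℝ) (π : Policy S A)
    (p : TransKernel S A) (H : ℕ) (s : S) (a : A) (s' : S) :
    ∑ l ∈ Finset.range (H + 1), γ ^ l * laterCost c π p l s a s' =
      c s a s' + γ * stepMean π p
        (fun s a s' => ∑ l ∈ Finset.range H, γ ^ l * laterCost c π p l s a s') s' := by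
  rw [Finset.sum_range_succ']
  simp only [laterCost, pow_zero, one_mul, stepMean, Finset.mul_sum]
  rw [add_comm, Finset.sum_comm]
  congr 1
  refine Finset.sum_congr rfl fun a _ => ?_
  rw [Finset.sum_comm]
  exact Finset.sum_congr rfl fun s' _ => Finset.sum_congr rfl fun l _ => by rw [pow_succ]; ring

theorem pmfMean_trajLaw (γ : ℝ) (c : S → A → S → ℝ) (π : Policy S A) (p : TransKernel S A)
    (H : ℕ) (x : S × A × S) :
    pmfMean (trajLaw π p H x) (trajCost γ c) =
      ∑ l ∈ Finset.range H, γ ^ l * laterCost c π p l x.1 x.2.1 x.2.2 := by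
  induction H generalizing x with
  | zero => simp [trajLaw, pmfMean_pure, trajCost]
  | succ H ih =>
    have hcons : ∀ τ : Fin H → S × A × S,
        trajCost γ c (Fin.cons x τ : Fin (H + 1) → S × A × S) =
          c x.1 x.2.1 x.2.2 + γ * trajCost γ c τ := fun τ => by
      simp only [trajCost, Fin.sum_univ_succ, Fin.cons_zero, Fin.cons_succ, Fin.val_zero,
        Fin.val_succ, pow_zero, one_mul, Finset.mul_sum, pow_succ]
      congr 1
      exact Finset.sum_congr rfl fun l _ => by ring
    simp only [trajLaw, pmfMean_bind, pmfMean_map, hcons, pmfMean_const_add_mul, ih]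
    rw [sum_range_laterCost_succ]
    simp only [pmfMean_toPMF, stepMean]

theorem abs_trajCost_le {S A : Type*} {γ : ℝ} (hγ0 : 0 < γ) (hγ1 : γ < 1) {c : S → A → S → ℝ} {C : ℝ}
    (hC : 0 < C) (hc : ∀ s a s', |c s a s'| ≤ C) {H : ℕ} (τ : Fin H → S × A × S) :
    |trajCost γ c τ| ≤ C / (1 - γ) := by
  calc |trajCost γ c τ| ≤ ∑ l : Fin H, |γ ^ (l : ℕ) * c (τ l).1 (τ l).2.1 (τ l).2.2| :=
        Finset.abs_sum_le_sum_abs _ _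
    _ ≤ ∑ l : Fin H, γ ^ (l : ℕ) * C := by
        refine Finset.sum_le_sum fun l _ => ?_
        rw [abs_mul, abs_of_pos (pow_pos hγ0 _)]
        exact mul_le_mul_of_nonneg_left (hc _ _ _) (pow_pos hγ0 _).le
    _ = (∑ l ∈ Finset.range H, γ ^ l) * C := by
        rw [← Finset.sum_mul, Fin.sum_univ_eq_sum_range fun l => γ ^ l]
    _ ≤ (1 - γ)⁻¹ * C := by
        refine mul_le_mul_of_nonneg_right ?_ hC.le
        rw [← tsum_geometric_of_lt_one hγ0.le hγ1]
        exact (summable_geometric_of_lt_one hγ0.le hγ1).sum_le_tsum _ fun l _ => (pow_pos hγ0 l).le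
    _ = C / (1 - γ) := (div_eq_inv_mul C _).symm

/-! ### Concentration of the Monte Carlo estimate -/

theorem toMeasure_indepPMF {ι β : Type*} [Fintype ι] [DecidableEq ι] [Fintype β]
    [MeasurableSpace β] [MeasurableSingletonClass β] (μ : ι → PMF β) :
    (indepPMF μ).toMeasure = Measure.pi fun i => (μ i).toMeasure := by
  refine Measure.ext_of_singleton fun f => ?_
  rw [PMF.toMeasure_apply_singleton _ _ (measurableSet_singleton f), Measure.pi_singleton]
  simp only [indepPMF, PMF.ofFintype_apply,
    PMF.toMeasure_apply_singleton _ _ (measurableSet_singleton _)]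

/-- Hoeffding's inequality, one-sided, for a family of independent bounded variables. -/
theorem indepPMF_hoeffding {ι β : Type*} [Fintype ι] [DecidableEq ι] [Fintype β] (μ : ι → PMF β)
    {b : ℝ} (X : β → ℝ) (hX : ∀ x, |X x| ≤ b) (s : Finset ι) {τ : ℝ} (hτ : 0 ≤ τ) :
    (indepPMF μ).toOuterMeasure {ω | τ ≤ ∑ i ∈ s, (X (ω i) - pmfMean (μ i) X)} ≤
      ENNReal.ofReal (Real.exp (-τ ^ 2 / (2 * (s.card * b ^ 2)))) := by
  let _ : MeasurableSpace β := ⊤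
  have : MeasurableSingletonClass β := ⟨fun _ => trivial⟩
  have hmean : ∀ i, ∫ x, X x ∂(μ i).toMeasure = pmfMean (μ i) X := fun i => by
    rw [PMF.integral_eq_sum]
    rfl
  have hsub : ∀ i, HasSubgaussianMGF (fun x => X x - pmfMean (μ i) X)
      ((‖b - -b‖₊ / 2) ^ 2) (μ i).toMeasure := fun i => by
    rw [← hmean i]
    exact hasSubgaussianMGF_of_mem_Icc (measurable_of_finite X).aemeasurable
      (Filter.Eventually.of_forall fun x => abs_le.1 (hX x))
  have hpi : iIndepFun (fun (i : ι) (ω : ι → β) => X (ω i) - pmfMean (μ i) X)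
      (Measure.pi fun i => (μ i).toMeasure) :=
    iIndepFun_pi (X := fun i x => X x - pmfMean (μ i) X) fun i =>
      (measurable_of_finite _).aemeasurable
  have hsub' : ∀ i ∈ s, HasSubgaussianMGF (fun ω : ι → β => X (ω i) - pmfMean (μ i) X)
      ((‖b - -b‖₊ / 2) ^ 2) (Measure.pi fun i => (μ i).toMeasure) := fun i _ => by
    refine HasSubgaussianMGF.of_map (Y := fun ω : ι → β => ω i)
      (X := fun x => X x - pmfMean (μ i) X) (measurable_pi_apply i).aemeasurable ?_
    rw [(measurePreserving_eval (fun i => (μ i).toMeasure) i).map_eq]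
    exact hsub i
  have hb : ((‖b - -b‖₊ / 2) ^ 2 : NNReal) = (b ^ 2 : ℝ) := by
    simp only [NNReal.coe_pow, NNReal.coe_div, coe_nnnorm, Real.norm_eq_abs, NNReal.coe_ofNat,
      div_pow, sq_abs]
    ring
  have key := HasSubgaussianMGF.measure_sum_ge_le_of_iIndepFun hpi hsub' hτ
  rw [Finset.sum_const, nsmul_eq_mul, NNReal.coe_mul, hb, NNReal.coe_natCast,
    ← toMeasure_indepPMF] at key
  rw [← PMF.toMeasure_apply_eq_toOuterMeasure, ← ofReal_measureReal]
  exact ENNReal.ofReal_le_ofReal key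

/-- Hoeffding's inequality for the average of the trajectories of one index of a mini-batch. -/
theorem estimate_hoeffding [DecidableEq S] [DecidableEq A] {γ : ℝ} (hγ0 : 0 < γ) (hγ1 : γ < 1)
    {c : S → A → S → ℝ} {C : ℝ} (hC : 0 < C) (hc : ∀ s a s', |c s a s'| ≤ C) (π : Policy S A)
    (p : TransKernel S A) {N : ℕ} (hN : 0 < N) (H : ℕ) {τ : ℝ} (hτ : 0 ≤ τ) (s : S) (a : A)
    (s' : S) :
    (batchLaw π p N H).toOuterMeasure {ω | τ < |estimate γ c ω s a s' -
        ∑ l ∈ Finset.range H, γ ^ l * laterCost c π p l s a s'|} ≤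
      ENNReal.ofReal (2 * Real.exp (-(N * τ ^ 2 / (2 * (C / (1 - γ)) ^ 2)))) := by
  set m := ∑ l ∈ Finset.range H, γ ^ l * laterCost c π p l s a s' with hm
  have hN' : (0 : ℝ) < N := Nat.cast_pos.2 hN
  set J : Finset ((S × A × S) × Fin N) :=
    Finset.univ.map ⟨fun j => ((s, a, s'), j), fun i j hij => (Prod.ext_iff.1 hij).2⟩ with hJ
  have hcard : J.card = N := by simp [hJ]
  have hsum : ∀ F : (S × A × S) × Fin N → ℝ, ∑ i ∈ J, F i = ∑ j : Fin N, F ((s, a, s'), j) :=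
    fun F => by
      rw [hJ, Finset.sum_map]
      rfl
  have hmean : pmfMean (trajLaw π p H (s, a, s')) (trajCost γ c) = m :=
    pmfMean_trajLaw γ c π p H (s, a, s')
  have hmean' : pmfMean (trajLaw π p H (s, a, s')) (fun τ => -trajCost γ c τ) = -m := by
    have := pmfMean_const_add_mul (trajLaw π p H (s, a, s')) 0 (-1) (trajCost γ c)
    rw [hmean] at this
    simpa only [zero_add, neg_mul, one_mul] using this
  clear_value m
  have hest : ∀ ω : Batch S A N H, estimate γ c ω s a s' =
      1 / (N : ℝ) * ∑ j : Fin N, trajCost γ c (ω ((s, a, s'), j)) := fun ω => rfl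
  have hexp : -(N * τ) ^ 2 / (2 * (J.card * (C / (1 - γ)) ^ 2)) =
      -(N * τ ^ 2 / (2 * (C / (1 - γ)) ^ 2)) := by
    have h1 : (0 : ℝ) < 1 - γ := by linarith
    rw [hcard]
    field_simp
  have hup := indepPMF_hoeffding (fun i : (S × A × S) × Fin N => trajLaw π p H i.1)
    (trajCost γ c) (abs_trajCost_le hγ0 hγ1 hC hc) J (mul_nonneg hN'.le hτ)
  have hlo := indepPMF_hoeffding (fun i : (S × A × S) × Fin N => trajLaw π p H i.1)
    (fun τ => -trajCost γ c τ) (fun τ => by rw [abs_neg]; exact abs_trajCost_le hγ0 hγ1 hC hc τ) J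
    (mul_nonneg hN'.le hτ)
  rw [hexp] at hup hlo
  rw [two_mul, ENNReal.ofReal_add (Real.exp_pos _).le (Real.exp_pos _).le]
  refine le_trans (measure_mono fun ω hω => ?_)
    ((measure_union_le _ _).trans (add_le_add hup hlo))
  have hω : τ < |estimate γ c ω s a s' - m| := hω
  have e1 : N * (estimate γ c ω s a s' - m) =
      ∑ j : Fin N, (trajCost γ c (ω ((s, a, s'), j)) - m) := by
    rw [hest, Finset.sum_sub_distrib, Finset.sum_const, Finset.card_univ, Fintype.card_fin,
      nsmul_eq_mul]
    field_simp
  rcases lt_abs.1 hω with h | h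
  · left
    rw [Set.mem_ofPred_eq]
    simp only [hsum, hmean, ← e1]
    exact mul_le_mul_of_nonneg_left h.le hN'.le
  · right
    rw [Set.mem_ofPred_eq]
    simp only [hsum, hmean']
    have e2 : ∑ j : Fin N, (-trajCost γ c (ω ((s, a, s'), j)) - -m) =
        N * -(estimate γ c ω s a s' - m) := by
      rw [mul_neg, e1, ← Finset.sum_neg_distrib]
      exact Finset.sum_congr rfl fun j _ => by ring
    rw [e2]
    exact mul_le_mul_of_nonneg_left h.le hN'.le

/-- With high probability a mini-batch estimates the action next-state value function uniformly:
the error is that of truncating at the horizon plus the deviation `τ` of the averages. -/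
theorem estimate_uniform [DecidableEq S] [DecidableEq A] {γ : ℝ} (hγ0 : 0 < γ) (hγ1 : γ < 1)
    {c : S → A → S → ℝ} {C : ℝ} (hC : 0 < C) (hc : ∀ s a s', |c s a s'| ≤ C) (π : Policy S A)
    (p : TransKernel S A) {N : ℕ} (hN : 0 < N) (H : ℕ) {τ : ℝ} (hτ : 0 ≤ τ) :
    (batchLaw π p N H).toOuterMeasure {ω | ¬∀ s a s',
        |estimate γ c ω s a s' - nextValue γ c π p s a s'| ≤ τ + γ ^ H * (C / (1 - γ))} ≤
      ENNReal.ofReal ((Fintype.card S : ℝ) ^ 2 * Fintype.card A *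
        (2 * Real.exp (-(N * τ ^ 2 / (2 * (C / (1 - γ)) ^ 2))))) := by
  set κ := 2 * Real.exp (-(N * τ ^ 2 / (2 * (C / (1 - γ)) ^ 2)))
  calc _ ≤ (batchLaw π p N H).toOuterMeasure (⋃ x : S × A × S, {ω |
          τ < |estimate γ c ω x.1 x.2.1 x.2.2 -
            ∑ l ∈ Finset.range H, γ ^ l * laterCost c π p l x.1 x.2.1 x.2.2|}) := by
        refine measure_mono fun ω hω => ?_
        by_contra hcon
        refine hω fun s a s' => ?_
        have h1 : |estimate γ c ω s a s' -
            ∑ l ∈ Finset.range H, γ ^ l * laterCost c π p l s a s'| ≤ τ :=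
          not_lt.1 fun h => hcon (Set.mem_iUnion.2 ⟨(s, a, s'), h⟩)
        have h2 := abs_nextValue_sub_sum_range_le hγ0 hγ1 hc π p H s a s'
        rw [abs_sub_comm] at h2
        exact (abs_sub_le _ _ _).trans (add_le_add h1 h2)
    _ ≤ ∑ x : S × A × S, ENNReal.ofReal κ :=
        (measure_iUnion_fintype_le _ _).trans (Finset.sum_le_sum fun x _ =>
          estimate_hoeffding hγ0 hγ1 hC hc π p hN H hτ x.1 x.2.1 x.2.2)
    _ = _ := by
        rw [Finset.sum_const, Finset.card_univ, nsmul_eq_mul, ← ENNReal.ofReal_natCast,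
          ← ENNReal.ofReal_mul (Nat.cast_nonneg _)]
        congr 2
        simp only [Fintype.card_prod, Nat.cast_mul]
        ring

/-- A union bound along a Markov chain: if each step from a good state ends in a bad state with
probability at most `κ`, then the state after `t` steps is bad with probability at most `t κ`. -/
theorem approxTMA_bad_le [DecidableEq S] [DecidableEq A] (γ : ℝ) (c : S → A → S → ℝ)
    (π : Policy S A) (upd : ℕ → TransKernel S A → (S → A → S → ℝ) → TransKernel S A)
    (p0 : TransKernel S A) (N H : ℕ) (good : ℕ → TransKernel S A → Prop) (κ : ENNReal)
    (h0 : good 0 p0)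
    (hstep : ∀ t p, good t p → (batchLaw π p N H).toOuterMeasure
      {ω | ¬good (t + 1) (upd t p (estimate γ c ω))} ≤ κ) (t : ℕ) :
    (approxTMA γ c π upd p0 N H t).toOuterMeasure {x | ¬good t x.1} ≤ t * κ := by
  induction t with
  | zero =>
    simp [approxTMA, h0]
  | succ t ih =>
    set P := approxTMA γ c π upd p0 N H t
    have hpt : ∀ x : TransKernel S A × ℕ, P x * ((batchLaw π x.1 N H).map fun ω =>
        (upd t x.1 (estimate γ c ω), x.2 + batchSize S A N H)).toOuterMeasure
          {x | ¬good (t + 1) x.1} ≤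
        Set.indicator {x | ¬good t x.1} P x + P x * κ := fun x => by
      rw [PMF.toOuterMeasure_map_apply]
      by_cases hx : good t x.1
      · exact (mul_le_mul_right (hstep t x.1 hx) _).trans le_add_self
      · rw [Set.indicator_of_mem (show x ∈ {x : TransKernel S A × ℕ | ¬good t x.1} from hx)]
        refine le_add_right (mul_le_of_le_one_right' ?_)
        exact (measure_mono (Set.subset_univ _)).trans
          ((PMF.toOuterMeasure_apply_eq_one_iff _ Set.univ).2 (Set.subset_univ _)).le
    rw [approxTMA, PMF.toOuterMeasure_bind_apply]
    calc _ ≤ ∑' x, (Set.indicator {x | ¬good t x.1} P x + P x * κ) := ENNReal.tsum_le_tsum hpt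
      _ = P.toOuterMeasure {x | ¬good t x.1} + κ := by
          rw [ENNReal.tsum_add, ENNReal.tsum_mul_right, P.tsum_coe, one_mul,
            PMF.toOuterMeasure_apply]
      _ ≤ t * κ + κ := add_le_add_left ih κ
      _ = (t + 1 : ℕ) * κ := by
          push_cast
          ring

theorem approxTMA_samples [DecidableEq S] [DecidableEq A] (γ : ℝ) (c : S → A → S → ℝ)
    (π : Policy S A) (upd : ℕ → TransKernel S A → (S → A → S → ℝ) → TransKernel S A)
    (p0 : TransKernel S A) (N H t : ℕ) :
    ∀ x ∈ (approxTMA γ c π upd p0 N H t).support,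
      x.2 = Fintype.card S ^ 2 * Fintype.card A * t * H * N := by
  induction t with
  | zero => simp [approxTMA]
  | succ t ih =>
    intro x hx
    simp only [approxTMA, PMF.mem_support_bind_iff, PMF.mem_support_map_iff] at hx
    obtain ⟨y, hy, ω, -, rfl⟩ := hx
    simp only [ih y hy, batchSize, Fintype.card_prod, Fintype.card_fin]
    ring

/-! ### Choice of the parameters -/

/-- The mini-batch size makes the union bound over `K` triples and `T` iterations at most `δ`; here
`b` bounds the variables and `b / x` is the tolerated deviation. -/
theorem union_bound_le {K T δ b x N : ℝ} (hK : 0 < K) (hT : 0 < T) (hδ : 0 < δ)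
    (hb : 0 < b) (hx : 0 < x) (hN : 2 * x ^ 2 * Real.log (2 * K * T / δ) ≤ N) :
    K * (2 * Real.exp (-(N * (b / x) ^ 2 / (2 * b ^ 2)))) ≤ δ / T := by
  have h1 : Real.log (2 * K * T / δ) ≤ N * (b / x) ^ 2 / (2 * b ^ 2) := by
    calc Real.log (2 * K * T / δ)
        = (2 * x ^ 2 * Real.log (2 * K * T / δ)) / (2 * x ^ 2) := by field_simp
      _ ≤ N / (2 * x ^ 2) := div_le_div_of_nonneg_right hN (by positivity)
      _ = _ := by field_simp
  calc K * (2 * Real.exp (-(N * (b / x) ^ 2 / (2 * b ^ 2))))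
      ≤ K * (2 * Real.exp (-Real.log (2 * K * T / δ))) := by gcongr
    _ = δ / T := by
      rw [Real.exp_neg, Real.exp_log (by positivity)]
      field_simp

theorem pow_mul_le_one_of_logb_le {γ x : ℝ} (hγ0 : 0 < γ) (hγ1 : γ < 1) (hx : 0 < x) {H : ℕ}
    (hH : Real.logb (1 / γ) x ≤ H) : γ ^ H * x ≤ 1 := by
  rw [Real.logb_le_iff_le_rpow ((one_lt_div hγ0).2 hγ1) hx, Real.rpow_natCast] at hH
  calc γ ^ H * x ≤ γ ^ H * (1 / γ) ^ H := by gcongr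
    _ = 1 := by rw [← mul_pow, mul_one_div_cancel hγ0.ne', one_pow]

theorem natCeil_le_one_add {x : ℝ} (hx : 0 ≤ x) : ((⌈x⌉₊ : ℕ) : ℝ) ≤ 1 + x := by
  linarith [Nat.ceil_lt_add_one hx]

/-- The base `M / (M - 1)` of the logarithm costs at most a factor `M`, by
`log (M / (M - 1)) ≥ 1 / M`. -/
theorem one_add_logb_le {M y : ℝ} (hM : 1 < M) (hy : 1 ≤ y) :
    1 + Real.logb (M / (M - 1)) y ≤ M * (1 + Real.log y) := by
  have hM0 : 0 < M := by linarith
  have hM1 : 0 < M - 1 := by linarith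
  have hlog := Real.one_sub_inv_le_log_of_pos (div_pos hM0 hM1)
  have h1 : 1 - (M / (M - 1))⁻¹ = 1 / M := by
    field_simp
    ring
  rw [h1] at hlog
  have hy0 : 0 ≤ Real.log y := Real.log_nonneg hy
  have h2 : Real.logb (M / (M - 1)) y ≤ M * Real.log y := by
    calc Real.log y / Real.log (M / (M - 1)) ≤ Real.log y / (1 / M) :=
          div_le_div_of_nonneg_left hy0 (by positivity) hlog
      _ = M * Real.log y := by rw [div_div_eq_mul_div, div_one, mul_comm]
  linarith

/-- Rounding up at most doubles the mini-batch size, because `2 x² log 2 ≥ 1`. -/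
theorem natCeil_batch_le {x L : ℝ} (hx : 1 ≤ x) (hL : Real.log 2 ≤ L) :
    ((⌈2 * x ^ 2 * L⌉₊ : ℕ) : ℝ) ≤ 4 * x ^ 2 * L := by
  have h2 := Real.log_two_gt_d9
  have h3 : 1 ≤ x ^ 2 := one_le_pow₀ hx
  have h4 : 1 ≤ 2 * x ^ 2 * L := by nlinarith
  linarith [natCeil_le_one_add (zero_le_one.trans h4)]

theorem sample_complexity {K γ C M ε δ : ℝ} (hK : 1 ≤ K) (hγ0 : 0 < γ) (hγ1 : γ < 1) (hC : 0 < C)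
    (hM : 1 < M) (hε : 0 < ε) (hδ0 : 0 < δ) (hδ1 : δ < 1) (hεC : ε ≤ 6 * C / (1 - γ)) {T H N : ℕ}
    (hT : T = ⌈Real.logb (M / (M - 1)) (6 * C / (ε * (1 - γ)))⌉₊)
    (hH : H = ⌈Real.logb (1 / γ) (16 * M * C / ((1 - γ) ^ 2 * ε))⌉₊)
    (hN : N = ⌈2 * (16 * M * C / ((1 - γ) ^ 2 * ε)) ^ 2 * Real.log (2 * K * T / δ)⌉₊) :
    K * T * H * N ≤ 1024 * (K * C ^ 2 * M ^ 2 / ((1 - γ) ^ 4 * ε ^ 2)) *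
        (1 + Real.logb (M / (M - 1)) (6 * C / (ε * (1 - γ)))) *
        (1 + Real.logb (1 / γ) (16 * M * C / ((1 - γ) ^ 2 * ε))) *
        Real.log (2 * K * T / δ) ∧
      K * T * H * N ≤ 1024 * (K * C ^ 2 * M ^ 3 / ((1 - γ) ^ 4 * ε ^ 2)) *
        (1 + Real.log (6 * C / (ε * (1 - γ)))) *
        (1 + Real.logb (1 / γ) (16 * M * C / ((1 - γ) ^ 2 * ε))) *
        Real.log (2 * K * T / δ) := by
  -- for `T = 0` both sides vanish, since `Real.log 0 = 0`
  rcases Nat.eq_zero_or_pos T with hT0 | hTpos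
  · simp [hT0]
  have h1 : 0 < 1 - γ := by linarith
  have hT1 : (1 : ℝ) ≤ T := by exact_mod_cast hTpos
  set y := 6 * C / (ε * (1 - γ)) with hy
  set x := 16 * M * C / ((1 - γ) ^ 2 * ε) with hx
  set L := Real.log (2 * K * T / δ) with hL
  have hy1 : 1 ≤ y := by
    rw [hy, one_le_div (by positivity)]
    exact (le_div_iff₀ h1).1 hεC
  have hyx : y ≤ x := by
    calc y = 6 * C / (ε * (1 - γ)) := hy
      _ ≤ 16 * M * C / (ε * (1 - γ)) := by
          refine div_le_div_of_nonneg_right ?_ (by positivity)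
          nlinarith
      _ ≤ 16 * M * C / ((1 - γ) ^ 2 * ε) := by
          refine div_le_div_of_nonneg_left (by positivity) (by positivity) ?_
          have : (1 - γ) ^ 2 ≤ 1 - γ := by nlinarith
          nlinarith
  have hx1 : 1 ≤ x := hy1.trans hyx
  have hL2 : Real.log 2 ≤ L := by
    refine Real.log_le_log two_pos ?_
    rw [le_div_iff₀ hδ0]
    have : 1 ≤ K * T := one_le_mul_of_one_le_of_one_le hK hT1
    nlinarith
  have hL0 : 0 ≤ L := (Real.log_pos one_lt_two).le.trans hL2
  have hbase : 1 < M / (M - 1) := by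
    rw [one_lt_div (by linarith)]
    linarith
  have hbase' : 1 < 1 / γ := (one_lt_div hγ0).2 hγ1
  have hly : 0 ≤ Real.logb (M / (M - 1)) y := Real.logb_nonneg hbase hy1
  have hlx : 0 ≤ Real.logb (1 / γ) x := Real.logb_nonneg hbase' hx1
  have hTb : (T : ℝ) ≤ 1 + Real.logb (M / (M - 1)) y := by
    rw [hT]
    exact natCeil_le_one_add hly
  have hHb : (H : ℝ) ≤ 1 + Real.logb (1 / γ) x := by
    rw [hH]
    exact natCeil_le_one_add hlx
  have hNb : (N : ℝ) ≤ 4 * x ^ 2 * L := by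
    rw [hN]
    exact natCeil_batch_le hx1 hL2
  have hbound : ∀ B : ℝ, (T : ℝ) ≤ B → K * T * H * N ≤
      1024 * (K * C ^ 2 * M ^ 2 / ((1 - γ) ^ 4 * ε ^ 2)) * B *
        (1 + Real.logb (1 / γ) x) * L := fun B hB => by
    have hB0 : 0 ≤ B := (Nat.cast_nonneg T).trans hB
    calc K * T * H * N ≤ K * B * (1 + Real.logb (1 / γ) x) * (4 * x ^ 2 * L) := by gcongr
      _ = _ := by
        rw [hx]
        field_simp
        ring
  refine ⟨hbound _ hTb, (hbound _ (hTb.trans (one_add_logb_le hM hy1))).trans_eq ?_⟩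
  ring

end ApproxTMA

theorem mainTheorem4 {S A : Type*} [Fintype S] [Fintype A] [DecidableEq S] [DecidableEq A]
    -- the decision process: discount factor, bounded cost, exploratory starting distribution
    (γ : ℝ) (hγ0 : 0 < γ) (hγ1 : γ < 1)
    (c : S → A → S → ℝ) (C : ℝ) (hC : 0 < C) (hc : ∀ s a s', |c s a s'| ≤ C)
    (ρ : stdSimplex ℝ S) (hρ : ∀ s, 0 < ρ.1 s)
    -- the policy class and the fixed policy
    (Pol : Set (Policy S A)) (π : Policy S A) (hπ : π ∈ Pol)
    -- the convex rectangular uncertainty set and the distance generating functions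
    (U : S → Set (A → S → ℝ)) (hU : ∀ s, ∀ k ∈ U s, ∀ a, k a ∈ stdSimplex ℝ S)
    (h : S → (A → S → ℝ) → ℝ) (hh : ∀ s, IsDistanceGenerating (U s) (h s))
    -- a worst-case kernel and the initial kernel
    (pstar : TransKernel S A) (hpstar : pstar ∈ rectSet U)
    (hopt : IsMaxOn (value γ c ρ π) (rectSet U) pstar)
    (p0 : TransKernel S A) (hp0 : p0 ∈ rectSet U)
    (hp0d : ∀ s, DifferentiableWithinAt ℝ (h s) (U s) (block p0 s))
    -- step sizes and penalty
    (α : ℝ) (hα : 0 < α) (η : ℕ → ℝ) (hη0 : 0 < η 0)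
    (hη : α / C * ((1 - γ) / γ) *
      weightedBregman U h (visitation γ ρ π pstar) pstar p0 ≤ η 0)
    (hηs : ∀ t, η (t + 1) = η t / γ)
    -- the algorithm's choice of maximisers
    (upd : ℕ → TransKernel S A → (S → A → S → ℝ) → TransKernel S A)
    (hupd : IsTMAUpdate γ ρ π U h η α upd)
    -- accuracy and confidence
    (ε δ : ℝ) (hε : 0 < ε) (hδ0 : 0 < δ) (hδ1 : δ < 1) :
    -- the normalised mismatch coefficient is an admissible value of `M` below
    (1 / (1 - γ) ≤ mismatch γ ρ Pol (rectSet U) / (1 - γ) ∧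
      densityRatio γ ρ π (rectSet U) pstar ≤ mismatch γ ρ Pol (rectSet U) / (1 - γ)) ∧
    ∀ M : ℝ, 1 / (1 - γ) ≤ M → densityRatio γ ρ π (rectSet U) pstar ≤ M →
      -- regret guarantee and exact number of samples
      (∀ T H N : ℕ,
        Real.logb (M / (M - 1)) (6 * C / (ε * (1 - γ))) ≤ T →
        Real.logb (1 / γ) (16 * M * C / ((1 - γ) ^ 2 * ε)) ≤ H →
        2 * (16 * M * C / ((1 - γ) ^ 2 * ε)) ^ 2 *
            Real.log (2 * (Fintype.card S : ℝ) ^ 2 * Fintype.card A * T / δ) ≤ N →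
        ENNReal.ofReal (1 - δ) ≤
            (approxTMA γ c π upd p0 N H T).toOuterMeasure
              {x | x.1 ∈ rectSet U ∧ value γ c ρ π pstar - value γ c ρ π x.1 ≤ ε} ∧
          ∀ x ∈ (approxTMA γ c π upd p0 N H T).support,
            x.2 = Fintype.card S ^ 2 * Fintype.card A * T * H * N) ∧
      -- sample complexity for the smallest admissible parameters
      (ε ≤ 6 * C / (1 - γ) →
        ∀ T H N : ℕ,
        T = ⌈Real.logb (M / (M - 1)) (6 * C / (ε * (1 - γ)))⌉₊ →
        H = ⌈Real.logb (1 / γ) (16 * M * C / ((1 - γ) ^ 2 * ε))⌉₊ →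
        N = ⌈2 * (16 * M * C / ((1 - γ) ^ 2 * ε)) ^ 2 *
            Real.log (2 * (Fintype.card S : ℝ) ^ 2 * Fintype.card A * T / δ)⌉₊ →
        ∀ x ∈ (approxTMA γ c π upd p0 N H T).support,
          (x.2 : ℝ) ≤ 1024 *
              ((Fintype.card S : ℝ) ^ 2 * Fintype.card A * C ^ 2 * M ^ 2 / ((1 - γ) ^ 4 * ε ^ 2)) *
              (1 + Real.logb (M / (M - 1)) (6 * C / (ε * (1 - γ)))) *
              (1 + Real.logb (1 / γ) (16 * M * C / ((1 - γ) ^ 2 * ε))) *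
              Real.log (2 * (Fintype.card S : ℝ) ^ 2 * Fintype.card A * T / δ) ∧
          (x.2 : ℝ) ≤ 1024 *
              ((Fintype.card S : ℝ) ^ 2 * Fintype.card A * C ^ 2 * M ^ 3 / ((1 - γ) ^ 4 * ε ^ 2)) *
              (1 + Real.log (6 * C / (ε * (1 - γ)))) *
              (1 + Real.logb (1 / γ) (16 * M * C / ((1 - γ) ^ 2 * ε))) *
              Real.log (2 * (Fintype.card S : ℝ) ^ 2 * Fintype.card A * T / δ)) := by
  classical
  have h1 : 0 < 1 - γ := by linarith
  have hS : Nonempty S := by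
    by_contra hS
    rw [not_nonempty_iff] at hS
    simpa using simplex_sum ρ
  have hA : Nonempty A := by
    by_contra hA
    rw [not_nonempty_iff] at hA
    simpa using simplex_sum (π hS.some)
  refine ⟨⟨div_le_div_of_nonneg_right (one_le_mismatch hγ0 hγ1 hρ hπ hpstar) h1.le,
    densityRatio_le_mismatch_div hγ0 hγ1 hρ hπ hpstar⟩, fun M hM1 hM => ?_⟩
  have hM1' : 1 < M := by
    refine lt_of_lt_of_le ?_ hM1
    rw [one_lt_div h1]
    linarith
  have hM0 : 0 < M := one_pos.trans hM1'
  set K : ℝ := (Fintype.card S : ℝ) ^ 2 * Fintype.card A with hKdef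
  have hK : 1 ≤ K := by
    have hS1 : (1 : ℝ) ≤ Fintype.card S := by exact_mod_cast Fintype.card_pos
    have hA1 : (1 : ℝ) ≤ Fintype.card A := by exact_mod_cast Fintype.card_pos
    exact one_le_mul_of_one_le_of_one_le (one_le_pow₀ hS1) hA1
  have hassoc : ∀ T : ℕ, 2 * (Fintype.card S : ℝ) ^ 2 * Fintype.card A * T / δ = 2 * K * T / δ :=
    fun T => by rw [hKdef, ← mul_assoc]
  simp only [hassoc]
  refine ⟨fun T H N hT hH hN => ⟨?_, approxTMA_samples γ c π upd p0 N H T⟩,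
    fun hεC T H N hT hH hN x hx => ?_⟩
  · have hηpos : ∀ t, 0 < η t := fun t => by
      induction t with
      | zero => exact hη0
      | succ t ih =>
        rw [hηs]
        exact div_pos ih hγ0
    -- half of the tolerated error `e` is left to the truncation, half to the sampling
    set e := ε * (1 - γ) / (8 * M) with he
    set x := 16 * M * C / ((1 - γ) ^ 2 * ε) with hx
    set b := C / (1 - γ) with hb
    have hx0 : 0 < x := by positivity
    have hb0 : 0 < b := by positivity
    have he0 : 0 ≤ e := by positivity
    have hex : b / x + b / x = e := by
      rw [hb, hx, he]
      field_simp
      norm_num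
    have hγH : γ ^ H * b ≤ b / x := by
      rw [le_div_iff₀ hx0]
      calc γ ^ H * b * x = γ ^ H * x * b := by ring
        _ ≤ 1 * b := by
            gcongr
            exact pow_mul_le_one_of_logb_le hγ0 hγ1 hx0 hH
        _ = b := one_mul b
    have hgood0 := isGood_zero (π := π) hγ0 hγ1 hC hc hp0 hp0d hη0 hη hM1 he0
    set good := IsGood γ c C ρ π U h pstar η α M e with hgood
    set P := approxTMA γ c π upd p0 N H T with hP
    have hbad : P.toOuterMeasure {x | ¬good T x.1} ≤ ENNReal.ofReal δ := by
      -- for `T = 0` the batch size may be zero, but no step is taken and any bound per step will do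
      rcases Nat.eq_zero_or_pos T with rfl | hTpos
      · have := approxTMA_bad_le γ c π upd p0 N H good ⊤ hgood0 (fun _ _ _ => le_top) 0
        rw [Nat.cast_zero, zero_mul] at this
        exact this.trans zero_le
      have hT0 : (0 : ℝ) < T := Nat.cast_pos.2 hTpos
      have hNpos : 0 < N := by
        have hlog : 0 < Real.log (2 * K * T / δ) := by
          refine Real.log_pos ?_
          rw [one_lt_div hδ0]
          have hT1 : (1 : ℝ) ≤ T := by exact_mod_cast hTpos
          have : 1 ≤ K * T := one_le_mul_of_one_le_of_one_le hK hT1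
          linarith
        have : (0 : ℝ) < N := lt_of_lt_of_le (by positivity) hN
        exact_mod_cast this
      have hstep : ∀ t p, good t p → (batchLaw π p N H).toOuterMeasure
          {ω | ¬good (t + 1) (upd t p (estimate γ c ω))} ≤ ENNReal.ofReal (δ / T) := by
        intro t p hp
        refine (MeasureTheory.measure_mono ?_).trans
          ((estimate_uniform hγ0 hγ1 hC hc π p hNpos H (div_pos hb0 hx0).le).trans
            (ENNReal.ofReal_le_ofReal
              (union_bound_le (zero_lt_one.trans_le hK) hT0 hδ0 hb0 hx0 hN)))
        intro ω hω hacc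
        exact hω <| hp.step hγ0 hγ1 hρ hU hh hpstar hα hηpos hηs hupd hM1 hM fun s a s' =>
          (hacc s a s').trans (by linarith)
      refine (approxTMA_bad_le γ c π upd p0 N H good _ hgood0 hstep T).trans_eq ?_
      rw [← ENNReal.ofReal_natCast, ← ENNReal.ofReal_mul hT0.le, mul_div_cancel₀ _ hT0.ne']
    rw [ENNReal.ofReal_sub _ hδ0.le, ENNReal.ofReal_one, tsub_le_iff_right]
    calc (1 : ENNReal) = P.toOuterMeasure Set.univ :=
          ((PMF.toOuterMeasure_apply_eq_one_iff P Set.univ).2 (Set.subset_univ _)).symm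
      _ ≤ P.toOuterMeasure ({x | x.1 ∈ rectSet U ∧
            value γ c ρ π pstar - value γ c ρ π x.1 ≤ ε} ∪ {x | ¬good T x.1}) := by
          refine MeasureTheory.measure_mono fun x _ => ?_
          by_cases hg : good T x.1
          · exact Or.inl ⟨hg.1, hg.gap_le hγ0 hγ1 hC hh hpstar hα hηpos hM1' hε he hT⟩
          · exact Or.inr hg
      _ ≤ _ := (MeasureTheory.measure_union_le _ _).trans (by gcongr)
  · have hx2 : (x.2 : ℝ) = K * T * H * N := by
      rw [approxTMA_samples γ c π upd p0 N H T x hx, hKdef]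
      push_cast
      ring
    rw [hx2]
    exact sample_complexity hK hγ0 hγ1 hC hM1' hε hδ0 hδ1 hεC hT hH hN
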